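/- Let $M$ be a compact connected manifold of real dimension $2n$ with a toric Kähler structure: a Riemannian metric $g$, an integrable complex structure $J$ for which $g$ is Hermitian, such that the form $\omega$ determined by $g=\omega(\cdot,J\cdot)$ is closed, and an effective action of $\mathbb T^n=\mathbb R^n/2\pi\mathbb Z^n$ by holomorphic maps with a moment map $\mu:M\to\mathfrak t^*\simeq\mathbb R^n$ (a $\mathbb T^n$-invariant map with $-d\langle\mu,b\rangle=\omega(X_b,\cdot)$, where $X_b$ is the fundamental vector field of $b\in\mathfrak t\simeq\mathbb R^n$). Assume that $M$ is Fano and that $\mu$ is normalized so that $$\mu(M)=P=-P_{alg}=\{x\in\mathbb R^n:\langle x,b_\rho\rangle\ge -1\ \text{for all }\rho\in\Delta(1)\},$$ where the $b_\rho\in\mathbb Z^n$ are the ray generators of the (nonsingular) fan of $M$; thus $P$ is a Delzant polytope, the $b_\rho$ being the normals of its facets. Assume that $(g,a)$, $a\in\mathfrak t$, is a Kähler–Ricci soliton with Einstein constant $1$, i.e. $\mathrm{Ric}(\omega)-\omega=\mathcal L_X\omega$ with $X=JX_a+\sqrt{-1}\,X_a$. Let $P^0$ be the interior of $P$ and $M^0=\mu^{-1}(P^0)\simeq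 P^0\times\mathbb T^n$, with action-angle coordinates $(x,t)$ in which $\mu=x$, the torus acts by translations of $t$, $\omega=\sum_j dx_j\wedge dt_j$ and $g=\sum_{i,j}G_{ij}\,dx_idx_j+H_{ij}\,dt_idt_j$, where $\phi$ is the symplectic potential of $g$, $G=\mathrm{Hess}\,\phi$ and $H=G^{-1}$. Here a symplectic potential is a continuous function on $P$ which is smooth and strictly convex on the relative interior of every face of $P$ (including $P^0$) and which differs from $\frac12\sum_\rho L_\rho\log L_\rho$, $L_\rho=\langle x,b_\rho\rangle+1$, by the restriction of a function smooth on a neighbourhood of $P$. Put $z_k=\partial\phi/\partial x_k+\sqrt{-1}\,t_k$ and let $\tau_k=e^{z_k}$ be the resulting coordinates $M^0\simeq(\mathbb C^\times)^n$. Let $\alpha\in\mathbb Z^n$ be a Demazure root: there is $\rho_\alpha\in\Delta(1)$ with $\langle\alpha,b_{\rho_\alpha}\rangle=1$ and $\langle\alpha,b_\rho\rangle\le 0$ for all $\rho\ne\rho_\alpha$. Define on $M^0$ the Demazure vector field and the root function $$V_\alpha=\prod_{i=1}^n\tau_i^{-\alpha_i}\sum_{k=1}^n(b_{\rho_\alpha})_k\,\tau_k\frac{\partial}{\partial\tau_k},\qquad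 v_\alpha=(\langle\mu,b_{\rho_\alpha}\rangle+1)\exp\langle-\alpha,\nabla\phi+\sqrt{-1}\,t\rangle .$$ For a complex function $v$ put $\nabla_{g,J}v=\nabla_g\mathrm{Re}\,v+J\nabla_g\mathrm{Im}\,v$, and let $Y^{1,0}=\frac12(Y-\sqrt{-1}JY)$. Let $\Delta^a_{g,J}$ be the $\mathbb C$-linear extension of $$u\mapsto\Delta^g u+du(\nabla_g\langle\mu,2a\rangle)-\sqrt{-1}\,du(\nabla_\omega\langle\mu,2a\rangle),$$ where $\Delta^g=-\mathrm{div}\,\nabla_g$ and $\omega(\nabla_\omega h,\cdot)=-dh$. Then $v_\alpha$ is a well-defined smooth complex function on $M^0$, and on $M^0$ $$(\nabla_{g,J}v_\alpha)^{1,0}=V_\alpha\qquad\text{and}\qquad \Delta^a_{g,J}\overline{v_\alpha}-2\,\overline{v_\alpha}=0 .$$ -/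

import Mathlib

open Set Complex
open scoped Manifold ContDiff

noncomputable section

/-! ## Kähler geometry in real local coordinates

`Coord n = ℝ²ⁿ` is the coordinate space of local parametrizations of a manifold of real
dimension `2n`. Tensor fields on an open set of `Coord n` are written as functions. -/

/-- The coordinate space `ℝⁿ × ℝⁿ`. In action-angle coordinates `Sum.inl` indexes the actions
`x₁, …, xₙ` and `Sum.inr` the angles `t₁, …, tₙ`. -/
abbrev Coord (n : ℕ) : Type := Fin n ⊕ Fin n → ℝ

/-- Complexified tangent vectors `ℝ²ⁿ ⊗ ℂ`. -/
abbrev CCoord (n : ℕ) : Type := Fin n ⊕ Fin n → ℂ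

namespace LocalKahler

variable {n : ℕ}

/-- The partial derivative of `u` in the `i`-th coordinate. -/
def pd (u : Coord n → ℝ) (i : Fin n ⊕ Fin n) (y : Coord n) : ℝ :=
  fderiv ℝ u y (Pi.single i 1)

/-- The matrix of a metric in the coordinates. -/
def gram (g : Coord n → Coord n →L[ℝ] Coord n →L[ℝ] ℝ) (y : Coord n) :
    Matrix (Fin n ⊕ Fin n) (Fin n ⊕ Fin n) ℝ :=
  Matrix.of fun i j => g y (Pi.single i 1) (Pi.single j 1)

/-- The Kähler form `ω(X, Y) = g(J X, Y)`, i.e. `g = ω(·, J ·)`. -/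
def kahlerForm (g : Coord n → Coord n →L[ℝ] Coord n →L[ℝ] ℝ)
    (J : Coord n → Coord n →L[ℝ] Coord n) (y : Coord n) : Coord n →L[ℝ] Coord n →L[ℝ] ℝ :=
  (g y).comp (J y)

/-- The Riemannian gradient: `g(∇_g u, ·) = du`. -/
def grad (g : Coord n → Coord n →L[ℝ] Coord n →L[ℝ] ℝ) (u : Coord n → ℝ) (y : Coord n) :
    Coord n :=
  (g y).inverse (fderiv ℝ u y)

/-- The symplectic gradient of `u` for the symplectic form `Ω`: `Ω(∇_Ω u, ·) = - du`. -/
def symplGrad (Ω : Coord n → Coord n →L[ℝ] Coord n →L[ℝ] ℝ) (u : Coord n → ℝ) (y : Coord n) :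
    Coord n :=
  (Ω y).inverse (-fderiv ℝ u y)

/-- `∇_{g,J} v = ∇_g (Re v) + J ∇_g (Im v)` for a complex function `v`. -/
def cgrad (g : Coord n → Coord n →L[ℝ] Coord n →L[ℝ] ℝ) (J : Coord n → Coord n →L[ℝ] Coord n)
    (v : Coord n → ℂ) (y : Coord n) : Coord n :=
  grad g (fun z => (v z).re) y + J y (grad g (fun z => (v z).im) y)

/-- The `(1,0)`-part `(X - i J X) / 2` of a real tangent vector `X` at `y`. -/
def part10 (J : Coord n → Coord n →L[ℝ] Coord n) (y X : Coord n) : CCoord n :=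
  fun i => ((X i : ℂ) - I * (J y X i : ℂ)) / 2

/-- The nonnegative Laplace-Beltrami operator
`Δ^g u = - |g|^{-1/2} ∑ᵢⱼ ∂ᵢ (|g|^{1/2} gⁱʲ ∂ⱼ u) = - div ∇_g u`. -/
def laplacian (g : Coord n → Coord n →L[ℝ] Coord n →L[ℝ] ℝ) (u : Coord n → ℝ) (y : Coord n) : ℝ :=
  -(Real.sqrt (gram g y).det)⁻¹ *
    ∑ i, pd (fun z => Real.sqrt (gram g z).det * ∑ j, (gram g z)⁻¹ i j * pd u j z) i y

/-- The weighted Laplacian `Δ^{g,a} u = Δ^g u + du(∇_g h)`, where `h = ⟨μ, 2a⟩`. -/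
def weightedLaplacian (g : Coord n → Coord n →L[ℝ] Coord n →L[ℝ] ℝ) (h u : Coord n → ℝ)
    (y : Coord n) : ℝ :=
  laplacian g u y + fderiv ℝ u y (grad g h y)

/-- `B u = du(∇_ω h)`, where `h = ⟨μ, 2a⟩`. -/
def bOperator (g : Coord n → Coord n →L[ℝ] Coord n →L[ℝ] ℝ) (J : Coord n → Coord n →L[ℝ] Coord n)
    (h u : Coord n → ℝ) (y : Coord n) : ℝ :=
  fderiv ℝ u y (symplGrad (kahlerForm g J) h y)

/-- `Δ^{g,a} u - i B u` for a real function `u`. -/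
def complexLaplacianReal (g : Coord n → Coord n →L[ℝ] Coord n →L[ℝ] ℝ)
    (J : Coord n → Coord n →L[ℝ] Coord n) (h u : Coord n → ℝ) (y : Coord n) : ℂ :=
  (weightedLaplacian g h u y : ℂ) - I * (bOperator g J h u y : ℂ)

/-- The weighted complex Laplacian `Δ^a_{g,J} = Δ^{g,a} - i B`, extended `ℂ`-linearly to complex
functions; here `h = ⟨μ, 2a⟩`. -/
def complexLaplacian (g : Coord n → Coord n →L[ℝ] Coord n →L[ℝ] ℝ)
    (J : Coord n → Coord n →L[ℝ] Coord n) (h : Coord n → ℝ) (v : Coord n → ℂ) (y : Coord n) : ℂ :=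
  complexLaplacianReal g J h (fun z => (v z).re) y +
    I * complexLaplacianReal g J h (fun z => (v z).im) y

/-- `Z = (Z₁, …, Zₙ)` is a system of local holomorphic coordinates on `U` for `J`:
`dZ ∘ J = i dZ` and `dZ` is everywhere invertible. -/
def IsHolCoord (J : Coord n → Coord n →L[ℝ] Coord n) (U : Set (Coord n))
    (Z : Coord n → Fin n → ℂ) : Prop :=
  ContDiffOn ℝ ∞ Z U ∧ ∀ y ∈ U, (∀ v, fderiv ℝ Z y (J y v) = I • fderiv ℝ Z y v) ∧
    Function.Bijective (fderiv ℝ Z y)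

/-- The vector field `∂/∂Z_k = (∂/∂(Re Z_k) - i ∂/∂(Im Z_k)) / 2` of the complex coordinates
`Z`. -/
def wirtinger (Z : Coord n → Fin n → ℂ) (k : Fin n) (y : Coord n) : CCoord n :=
  fun i => (((fderiv ℝ Z y).inverse (Pi.single k 1) i : ℂ) -
    I * ((fderiv ℝ Z y).inverse (Pi.single k I) i : ℂ)) / 2

/-- The Hermitian matrix `g_{j k̄} = g(∂/∂Z_j, ∂/∂Z̄_k)`, with `g` extended bilinearly. -/
def hermMatrix (g : Coord n → Coord n →L[ℝ] Coord n →L[ℝ] ℝ) (Z : Coord n → Fin n → ℂ)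
    (y : Coord n) : Matrix (Fin n) (Fin n) ℂ :=
  Matrix.of fun j k => ∑ p, ∑ q,
    (gram g y p q : ℂ) * wirtinger Z j y p * (starRingEnd ℂ) (wirtinger Z k y q)

/-- `dᶜ u = - du ∘ J`. -/
def dc (J : Coord n → Coord n →L[ℝ] Coord n) (u : Coord n → ℝ) (y : Coord n) : Coord n →L[ℝ] ℝ :=
  -(fderiv ℝ u y).comp (J y)

/-- `d dᶜ u = 2 i ∂ ∂̄ u`, evaluated on two vectors. -/
def ddc (J : Coord n → Coord n →L[ℝ] Coord n) (u : Coord n → ℝ) (y X Y : Coord n) : ℝ :=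
  fderiv ℝ (dc J u) y X Y - fderiv ℝ (dc J u) y Y X

/-- The Ricci form `- i ∂ ∂̄ log det (g_{j k̄})`, computed with the holomorphic coordinates `Z`. -/
def ricciForm (g : Coord n → Coord n →L[ℝ] Coord n →L[ℝ] ℝ) (J : Coord n → Coord n →L[ℝ] Coord n)
    (Z : Coord n → Fin n → ℂ) (y X Y : Coord n) : ℝ :=
  -(1 / 2) * ddc J (fun z => Real.log (hermMatrix g Z z).det.re) y X Y

/-- The Lie derivative `L_W Ω` of a `2`-form along a real vector field `W`. -/
def lieForm (W : Coord n → Coord n) (Ω : Coord n → Coord n →L[ℝ] Coord n →L[ℝ] ℝ)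
    (y X Y : Coord n) : ℝ :=
  fderiv ℝ Ω y (W y) X Y + Ω y (fderiv ℝ W y X) Y + Ω y X (fderiv ℝ W y Y)

/-- The `2`-form `Ω` has `dΩ = 0` at `y`. -/
def IsClosedAt (Ω : Coord n → Coord n →L[ℝ] Coord n →L[ℝ] ℝ) (y : Coord n) : Prop :=
  ∀ X Y W : Coord n, fderiv ℝ Ω y X Y W + fderiv ℝ Ω y Y W X + fderiv ℝ Ω y W X Y = 0

end LocalKahler

/-! ## Toric Kähler manifolds -/

/-- The model space of `2n`-dimensional manifolds. -/
abbrev EModel (n : ℕ) : Type := EuclideanSpace ℝ (Fin (2 * n))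

/-- The torus `Tⁿ = ℝⁿ / 2πℤⁿ`. -/
abbrev Torus (n : ℕ) : Type := Fin n → Real.Angle

/-- The projection `𝔱 = ℝⁿ → Tⁿ`. -/
def toTorus {n : ℕ} (θ : Fin n → ℝ) : Torus n := fun i => (θ i : Real.Angle)

/-- The pairing of `𝔱* = ℝⁿ` with `𝔱 = ℝⁿ`. -/
def pairing {n : ℕ} (x b : Fin n → ℝ) : ℝ := ∑ i, x i * b i

section Manifold

variable {n : ℕ} {M : Type*} [TopologicalSpace M] [ChartedSpace (EModel n) M]

/-- `ψ` restricted to the open set `U ⊆ ℝ²ⁿ` is a smooth local parametrization of `M`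
(a local diffeomorphism). -/
def IsLocalParam (n : ℕ) {M : Type*} [TopologicalSpace M] [ChartedSpace (EModel n) M]
    (U : Set (Coord n)) (ψ : Coord n → M) : Prop :=
  IsOpen U ∧ IsLocalDiffeomorphOn 𝓘(ℝ, Coord n) (𝓡 (2 * n)) ∞ ψ U

/-- The differential of `ψ` at `y`. -/
def paramDeriv (ψ : Coord n → M) (y : Coord n) :
    Coord n →L[ℝ] TangentSpace (𝓡 (2 * n)) (ψ y) :=
  mfderiv 𝓘(ℝ, Coord n) (𝓡 (2 * n)) ψ y

/-- The pull-back `ψ^* g` of a metric. -/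
def pullMetric
    (g : ∀ p : M, TangentSpace (𝓡 (2 * n)) p →L[ℝ] TangentSpace (𝓡 (2 * n)) p →L[ℝ] ℝ)
    (ψ : Coord n → M) (y : Coord n) : Coord n →L[ℝ] Coord n →L[ℝ] ℝ :=
  let B : EModel n →L[ℝ] EModel n →L[ℝ] ℝ := g (ψ y)
  let D : Coord n →L[ℝ] EModel n := paramDeriv ψ y
  B.bilinearComp D D

/-- The pull-back `ψ^* J = dψ⁻¹ ∘ J ∘ dψ` of a field of endomorphisms. -/
def pullEnd (J : ∀ p : M, TangentSpace (𝓡 (2 * n)) p →L[ℝ] TangentSpace (𝓡 (2 * n)) p)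
    (ψ : Coord n → M) (y : Coord n) : Coord n →L[ℝ] Coord n :=
  (paramDeriv ψ y).inverse.comp ((J (ψ y)).comp (paramDeriv ψ y))

/-- The pull-back `ψ^* X = dψ⁻¹ (X ∘ ψ)` of a vector field. -/
def pullVector (X : ∀ p : M, TangentSpace (𝓡 (2 * n)) p) (ψ : Coord n → M) (y : Coord n) :
    Coord n :=
  (paramDeriv ψ y).inverse (X (ψ y))

/-- The fundamental vector field `X_b(p) = d/ds|_{s=0} exp(s b) · p` of `b ∈ 𝔱`. -/
def fundamentalField [AddAction (Torus n) M] (b : Fin n → ℝ) (p : M) :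
    TangentSpace (𝓡 (2 * n)) p :=
  (mfderiv 𝓘(ℝ, ℝ) (𝓡 (2 * n)) (fun s : ℝ => toTorus (s • b) +ᵥ p) 0 (1 : ℝ) : EModel n)

end Manifold

/-- A toric Kähler structure `(ω, J, Tⁿ, μ)` on a `2n`-dimensional manifold `M` (taken compact,
connected and Hausdorff in the theorem) on which the torus `Tⁿ` acts. -/
structure ToricKahler (n : ℕ) (M : Type*) [TopologicalSpace M] [ChartedSpace (EModel n) M]
    [IsManifold (𝓡 (2 * n)) ∞ M] [AddAction (Torus n) M] where
  /-- The Riemannian metric. -/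
  metric : Bundle.ContMDiffRiemannianMetric (𝓡 (2 * n)) ∞ (EModel n)
    (fun p : M => TangentSpace (𝓡 (2 * n)) p)
  /-- The complex structure. -/
  J : ∀ p : M, TangentSpace (𝓡 (2 * n)) p →L[ℝ] TangentSpace (𝓡 (2 * n)) p
  J_smooth : ContMDiff (𝓡 (2 * n)) ((𝓡 (2 * n)).prod 𝓘(ℝ, EModel n →L[ℝ] EModel n)) ∞
    (fun p => Bundle.TotalSpace.mk' (EModel n →L[ℝ] EModel n)
      (E := fun q : M => TangentSpace (𝓡 (2 * n)) q →L[ℝ] TangentSpace (𝓡 (2 * n)) q) p (J p))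
  J_sq : ∀ p v, J p (J p v) = -v
  J_isometry : ∀ p v w, metric.inner p (J p v) (J p w) = metric.inner p v w
  /-- `J` is integrable: there are local holomorphic coordinates around each point. -/
  J_integrable : ∀ p : M, ∃ (U : Set (Coord n)) (ψ : Coord n → M) (Z : Coord n → Fin n → ℂ),
    IsLocalParam n U ψ ∧ p ∈ ψ '' U ∧ LocalKahler.IsHolCoord (pullEnd J ψ) U Z
  /-- The Kähler form is closed. -/
  closed : ∀ (U : Set (Coord n)) (ψ : Coord n → M), IsLocalParam n U ψ → ∀ y ∈ U,
    LocalKahler.IsClosedAt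
      (LocalKahler.kahlerForm (pullMetric metric.inner ψ) (pullEnd J ψ)) y
  action_smooth : ContMDiff (𝓘(ℝ, Fin n → ℝ).prod (𝓡 (2 * n))) (𝓡 (2 * n)) ∞
    (fun q : (Fin n → ℝ) × M => toTorus q.1 +ᵥ q.2)
  action_effective : FaithfulVAdd (Torus n) M
  /-- The torus acts by holomorphic maps. -/
  action_holomorphic : ∀ (θ : Torus n) (p : M) (v : TangentSpace (𝓡 (2 * n)) p),
    mfderiv (𝓡 (2 * n)) (𝓡 (2 * n)) (fun q : M => θ +ᵥ q) p (J p v) =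
      J (θ +ᵥ p) (mfderiv (𝓡 (2 * n)) (𝓡 (2 * n)) (fun q : M => θ +ᵥ q) p v)
  /-- The moment map. -/
  μ : M → Fin n → ℝ
  μ_smooth : ContMDiff (𝓡 (2 * n)) 𝓘(ℝ, Fin n → ℝ) ∞ μ
  μ_invariant : ∀ (θ : Torus n) (p : M), μ (θ +ᵥ p) = μ p
  /-- `- d⟨μ, b⟩ = ω(X_b, ·)`, where `ω(X, Y) = g(J X, Y)`. -/
  μ_moment : ∀ (b : Fin n → ℝ) (p : M) (v : TangentSpace (𝓡 (2 * n)) p),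
    -(mfderiv (𝓡 (2 * n)) 𝓘(ℝ, ℝ) (fun q : M => pairing (μ q) b) p v : ℝ) =
      metric.inner p (J p (fundamentalField b p)) v

/-! ## Fano polytopes, Demazure roots and symplectic potentials -/

section Polytope

variable {n : ℕ} {ι : Type*} [Fintype ι]

/-- The affine function `L_ρ(x) = ⟨x, b_ρ⟩ + 1`. -/
def facetFun (b : ι → Fin n → ℤ) (ρ : ι) (x : Fin n → ℝ) : ℝ :=
  pairing x (fun i => (b ρ i : ℝ)) + 1

/-- The polytope `P = {x : ⟨x, b_ρ⟩ ≥ -1 for all ρ}`. It is `-P_alg` for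
`P_alg = {x : ⟨x, b_ρ⟩ ≤ 1 for all ρ}`. -/
def fanoPolytope (b : ι → Fin n → ℤ) : Set (Fin n → ℝ) := {x | ∀ ρ, 0 ≤ facetFun b ρ x}

/-- The `b_ρ` are the ray generators of the fan of a smooth toric Fano variety: `P` is
bounded, each `b_ρ` defines a facet of `P`, and at every vertex of `P` the normals of the facets
containing this vertex are a `ℤ`-basis of `ℤⁿ` (so `P` is a Delzant polytope). -/
def IsSmoothFano (b : ι → Fin n → ℤ) : Prop :=
  Bornology.IsBounded (fanoPolytope b) ∧
  (∀ ρ, ∃ x, facetFun b ρ x = 0 ∧ ∀ σ, σ ≠ ρ → 0 < facetFun b σ x) ∧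
  ∀ x ∈ (fanoPolytope b).extremePoints ℝ,
    LinearIndependent ℤ (fun ρ : {ρ // facetFun b ρ x = 0} => b ρ) ∧
    Submodule.span ℤ (b '' {ρ | facetFun b ρ x = 0}) = ⊤

/-- `α` is a Demazure root with `ρ_α = ρ`: `⟨α, b_ρ⟩ = 1` and `⟨α, b_σ⟩ ≤ 0` for `σ ≠ ρ`. -/
def IsDemazureRoot (b : ι → Fin n → ℤ) (α : Fin n → ℤ) (ρ : ι) : Prop :=
  ∑ i, α i * b ρ i = 1 ∧ ∀ σ, σ ≠ ρ → ∑ i, α i * b σ i ≤ 0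

/-- The relative interior of the face of `P` on which exactly the `L_ρ`, `ρ ∈ s`, vanish
(`s = ∅` gives the interior of `P`; the set is empty if `s` does not define a face). -/
def openFace (b : ι → Fin n → ℤ) (s : Set ι) : Set (Fin n → ℝ) :=
  {x | (∀ ρ ∈ s, facetFun b ρ x = 0) ∧ ∀ ρ, ρ ∉ s → 0 < facetFun b ρ x}

/-- The Guillemin potential `φ₀ = ½ ∑ L_ρ log L_ρ` (with `0 log 0 = 0`). -/
def guillemin (b : ι → Fin n → ℤ) (x : Fin n → ℝ) : ℝ :=
  (1 / 2) * ∑ ρ, facetFun b ρ x * Real.log (facetFun b ρ x)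

/-- The set `S(P)` of symplectic potentials of `P`. -/
def IsSymplecticPotential (b : ι → Fin n → ℤ) (φ : (Fin n → ℝ) → ℝ) : Prop :=
  ContinuousOn φ (fanoPolytope b) ∧
  (∀ s : Set ι, ContDiffOn ℝ ∞ φ (openFace b s) ∧ StrictConvexOn ℝ (openFace b s) φ) ∧
  ∃ (W : Set (Fin n → ℝ)) (h : (Fin n → ℝ) → ℝ), IsOpen W ∧ fanoPolytope b ⊆ W ∧
    ContDiffOn ℝ ∞ h W ∧ ∀ x ∈ fanoPolytope b, φ x = guillemin b x + h x

/-- The gradient `∇φ = (∂φ/∂x₁, …, ∂φ/∂xₙ)`. -/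
def euclGrad (φ : (Fin n → ℝ) → ℝ) (x : Fin n → ℝ) : Fin n → ℝ :=
  fun i => fderiv ℝ φ x (Pi.single i 1)

/-- The Hessian matrix `G` of `φ`. -/
def hessian (φ : (Fin n → ℝ) → ℝ) (x : Fin n → ℝ) : Matrix (Fin n) (Fin n) ℝ :=
  Matrix.of fun i j => fderiv ℝ (fun z => euclGrad φ z j) x (Pi.single i 1)

/-- The metric `∑ Gᵢⱼ dxᵢ dxⱼ + Hᵢⱼ dtᵢ dtⱼ`, with `G` the Hessian of `φ` and `H = G⁻¹`, evaluated
at `y = (x, t)` on two vectors. -/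
def potentialMetric (φ : (Fin n → ℝ) → ℝ) (y v w : Coord n) : ℝ :=
  ∑ i, ∑ j, (hessian φ (fun k => y (Sum.inl k)) i j * v (Sum.inl i) * w (Sum.inl j) +
    (hessian φ (fun k => y (Sum.inl k)))⁻¹ i j * v (Sum.inr i) * w (Sum.inr j))

/-- The domain `P⁰ × ℝⁿ` of action-angle coordinates (the angles being taken modulo `2π`). -/
def angleDomain (b : ι → Fin n → ℤ) : Set (Coord n) :=
  {y | (fun i => y (Sum.inl i)) ∈ interior (fanoPolytope b)}

/-- The logarithmic holomorphic coordinates `z_k = ∂φ/∂x_k + i t_k`. -/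
def logCoord (φ : (Fin n → ℝ) → ℝ) (y : Coord n) (k : Fin n) : ℂ :=
  (euclGrad φ (fun i => y (Sum.inl i)) k : ℂ) + I * (y (Sum.inr k) : ℂ)

/-- The coordinates `τ_k = exp(z_k)` which identify `M⁰` with the complex torus `(ℂˣ)ⁿ`. -/
def torusCoord (φ : (Fin n → ℝ) → ℝ) (y : Coord n) (k : Fin n) : ℂ := exp (logCoord φ y k)

/-- The Demazure vector field
`V_α = ∏ᵢ τᵢ^{-αᵢ} ∑ₖ (b_{ρ_α})ₖ τₖ ∂/∂τₖ` on `(ℂˣ)ⁿ`, in action-angle coordinates. -/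
def demazureField (φ : (Fin n → ℝ) → ℝ) (α β : Fin n → ℤ) (y : Coord n) : CCoord n :=
  (∏ i, torusCoord φ y i ^ (-α i)) •
    ∑ k, ((β k : ℂ) * torusCoord φ y k) • LocalKahler.wirtinger (torusCoord φ) k y

/-- The expression `(⟨x, b_ρ⟩ + 1) exp⟨-α, ∇φ + i t⟩` of the root function in action-angle
coordinates. -/
def rootExpr (b : ι → Fin n → ℤ) (φ : (Fin n → ℝ) → ℝ) (α : Fin n → ℤ) (ρ : ι) (y : Coord n) :
    ℂ :=
  (facetFun b ρ (fun i => y (Sum.inl i)) : ℂ) * exp (-∑ k, (α k : ℂ) * logCoord φ y k)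

/-- The root function `v_α = (⟨μ, b_ρ⟩ + 1) exp⟨-α, ∇φ + i t⟩` as a function on `M⁰`, for
action-angle coordinates `Ψ`; its value does not depend on the choice of the angles modulo `2π`. -/
def rootFunction {M : Type*} (b : ι → Fin n → ℤ) (Ψ : Coord n → M)
    (φ : (Fin n → ℝ) → ℝ) (α : Fin n → ℤ) (ρ : ι) (p : M) : ℂ :=
  rootExpr b φ α ρ (haveI : Nonempty (Coord n) := ⟨0⟩
    Function.invFunOn Ψ (angleDomain b) p)

end Polytope

namespace ToricKahler

variable {n : ℕ} {M : Type*} [TopologicalSpace M] [ChartedSpace (EModel n) M]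
  [IsManifold (𝓡 (2 * n)) ∞ M] [AddAction (Torus n) M] {ι : Type*} [Fintype ι]

/-- The expression of the metric `g` in a local parametrization. -/
def g (T : ToricKahler n M) (ψ : Coord n → M) : Coord n → Coord n →L[ℝ] Coord n →L[ℝ] ℝ :=
  pullMetric T.metric.inner ψ

/-- The expression of the complex structure in a local parametrization. -/
def cs (T : ToricKahler n M) (ψ : Coord n → M) : Coord n → Coord n →L[ℝ] Coord n :=
  pullEnd T.J ψ

/-- The expression of the Kähler form `ω` in a local parametrization. -/
def kform (T : ToricKahler n M) (ψ : Coord n → M) : Coord n → Coord n →L[ℝ] Coord n →L[ℝ] ℝ :=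
  LocalKahler.kahlerForm (T.g ψ) (T.cs ψ)

/-- `(g, a)` is a Kähler-Ricci soliton with Einstein constant `c`:
`Ric(ω) - c ω = L_X ω` with `X = J X_a + i X_a`. The equation is required in all local
parametrizations, the Ricci form being computed in arbitrary local holomorphic coordinates. -/
def IsKahlerRicciSoliton (T : ToricKahler n M) (c : ℝ) (a : Fin n → ℝ) : Prop :=
  ∀ (U : Set (Coord n)) (ψ : Coord n → M), IsLocalParam n U ψ →
  ∀ Z : Coord n → Fin n → ℂ, LocalKahler.IsHolCoord (T.cs ψ) U Z →
  ∀ y ∈ U, ∀ v w : Coord n,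
    ((LocalKahler.ricciForm (T.g ψ) (T.cs ψ) Z y v w - c * T.kform ψ y v w : ℝ) : ℂ) =
      (LocalKahler.lieForm
        (pullVector (fun p => T.J p (fundamentalField a p)) ψ) (T.kform ψ) y v w : ℂ) +
      I * (LocalKahler.lieForm (pullVector (fundamentalField a) ψ) (T.kform ψ) y v w : ℂ)

/-- `M⁰ = μ⁻¹(P⁰)`. -/
def openOrbit (T : ToricKahler n M) (b : ι → Fin n → ℤ) : Set M :=
  T.μ ⁻¹' interior (fanoPolytope b)

/-- `Ψ : P⁰ × ℝⁿ → M⁰` is a system of action-angle coordinates `(x, t)`: it identifies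
`P⁰ × ℝⁿ/2πℤⁿ` with `M⁰`, the moment map is `x`, the torus acts by translations of `t`, and
`ω = ∑ dxⱼ ∧ dtⱼ`. -/
structure IsActionAngle (T : ToricKahler n M) (b : ι → Fin n → ℤ) (Ψ : Coord n → M) : Prop where
  param : IsLocalParam n (angleDomain b) Ψ
  image : Ψ '' angleDomain b = T.openOrbit b
  injective : ∀ y ∈ angleDomain b, ∀ y' ∈ angleDomain b, Ψ y = Ψ y' →
    (∀ i, y (Sum.inl i) = y' (Sum.inl i)) ∧
      toTorus (fun i => y (Sum.inr i)) = toTorus (fun i => y' (Sum.inr i))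
  moment : ∀ y ∈ angleDomain b, T.μ (Ψ y) = fun i => y (Sum.inl i)
  equivariant : ∀ y ∈ angleDomain b, ∀ θ : Fin n → ℝ,
    Ψ (y + Sum.elim (fun _ => (0 : ℝ)) θ) = toTorus θ +ᵥ Ψ y
  symplectic : ∀ y ∈ angleDomain b, ∀ v w : Coord n,
    T.kform Ψ y v w = ∑ j, (v (Sum.inl j) * w (Sum.inr j) - v (Sum.inr j) * w (Sum.inl j))

/-- `φ ∈ S(P)` is the symplectic potential of `g` in the action-angle coordinates `Ψ`. -/
def IsPotentialOf (T : ToricKahler n M) (b : ι → Fin n → ℤ) (Ψ : Coord n → M)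
    (φ : (Fin n → ℝ) → ℝ) : Prop :=
  IsSymplecticPotential b φ ∧
    ∀ y ∈ angleDomain b, ∀ v w : Coord n, T.g Ψ y v w = potentialMetric φ y v w

/-- The operator `Δ^a_{g,J}` applied to a function `v` on `M`, in the local parametrization `ψ`. -/
def complexLaplacian (T : ToricKahler n M) (ψ : Coord n → M) (a : Fin n → ℝ) (v : M → ℂ)
    (y : Coord n) : ℂ :=
  LocalKahler.complexLaplacian (T.g ψ) (T.cs ψ)
    (fun z => pairing (T.μ (ψ z)) (fun i => 2 * a i)) (fun z => v (ψ z)) y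

/-- The field `(∇_{g,J} v)^{1,0}` of a function `v` on `M`, in the local parametrization `ψ`. -/
def grad10 (T : ToricKahler n M) (ψ : Coord n → M) (v : M → ℂ) (y : Coord n) : CCoord n :=
  LocalKahler.part10 (T.cs ψ) y
    (LocalKahler.cgrad (T.g ψ) (T.cs ψ) (fun z => v (ψ z)) y)

end ToricKahler

end

/-!
On the open orbit everything is explicit in action-angle coordinates. With `G = Hess φ` and
`H = G⁻¹`, the complex structure sends `∂/∂x_j` to `∑ G_jk ∂/∂t_k`, and the functions
`z_k = ∂φ/∂x_k + i t_k` are holomorphic coordinates, so the statement is about a Hessian metric on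
`P⁰ × ℝⁿ` (`IsHessianKahler`). Write `ρ` for the facet attached to the root `α`, `b` for its normal
and `L = ⟨x, b⟩ + 1`.

The `(1,0)`-part of the complex gradient of `v` only involves the `∂/∂z̄_k`-derivatives of `v`. The
root function is `L` times the holomorphic monomial `exp ⟨-α, z⟩`, so only `L` is differentiated,
and `∂L/∂x_j = b_j`. This gives the Demazure field (`IsHessianKahler.part10_cgrad_rootExpr`).

Since `⟨α, b⟩ = 1`, a similar computation shows that `Δᵃ v̄ - 2 v̄` is the conjugate monomial times
`2 ⟨-½ div H + H a - x, b⟩` (`IsHessianKahler.complexLaplacian_conj_rootExpr`). It remains to see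
that `⟨-½ div H + H a - x, b⟩` vanishes on `P⁰`, in two steps.

* The Ricci form is `-½ ddᶜ log det H`, and `H ∇ log det H = div H` by Jacobi's formula and the
  symmetry of the third derivatives of `φ` (`IsHessianPotential.sum_inv_mul_euclGrad_log_det`).
  Comparing the coefficients of `dx_j ∧ dt_k` in the soliton equation, the derivative of
  `-½ div H + H a - x` is zero, so this vector is constant on the connected set `P⁰`
  (`IsHessianKahler.exists_const_of_soliton`).
* The pairing of the constant with `b` is computed at the facet `L = 0`. There `φ = ½ L log L + S`
  with `S` smooth, so that `G = b bᵀ / (2L) + Hess S`. At a facet point where `Hess S` is definite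
  along the facet, a bordered linear system shows that `H b = 2 L R` with `R` smooth up to the
  facet and `⟨b, R⟩ = 1` on it (`exists_bordered_solution`). Hence `H b` tends to `0`, the divergence
  of `H b` tends to `2` and `⟨x, b⟩` tends to `-1`, so the pairing is `-1 + 0 + 1 = 0`
  (`IsSymplecticPotential.constant_eq_zero`). Strict convexity of `φ` along the facet does not make
  its Hessian definite everywhere, but the Hessian of a strictly convex function cannot be
  degenerate at every point (`StrictConvexOn.exists_hessian_pos`), so a suitable facet point exists.
-/

/-! ### Inverses and determinants of smooth families -/

theorem ContinuousLinearMap.inverse_apply_eq_of_bijective {E F : Type*} [NormedAddCommGroup E]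
    [NormedSpace ℝ E] [FiniteDimensional ℝ E] [NormedAddCommGroup F] [NormedSpace ℝ F]
    {f : E →L[ℝ] F} (hf : Function.Bijective f) {x : E} {w : F} (h : f x = w) :
    f.inverse w = x := by
  have he : f = ((LinearEquiv.ofBijective (f : E →ₗ[ℝ] F) hf).toContinuousLinearEquiv :
      E →L[ℝ] F) := by
    ext v
    rfl
  subst h
  have hi : f.IsInvertible := ⟨_, he.symm⟩
  exact hi.inverse_apply_self x

/-- Jacobi's formula: `d det A = tr (adj A · dA)`. -/
theorem hasFDerivAt_matrix_det {E m : Type*} [NormedAddCommGroup E] [NormedSpace ℝ E]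
    [Fintype m] [DecidableEq m] {A : E → Matrix m m ℝ} {A' : m → m → E →L[ℝ] ℝ} {x : E}
    (hA : ∀ i j, HasFDerivAt (fun z => A z i j) (A' i j) x) :
    HasFDerivAt (fun z => (A z).det) (∑ i, ∑ j, (A x).adjugate j i • A' i j) x := by
  have hterm := fun σ : Equiv.Perm m =>
    (HasFDerivAt.finsetProd (u := Finset.univ) (fun i _ => hA (σ i) i)).const_mul
      (((Equiv.Perm.sign σ : ℤ) : ℝ))
  have hsum := HasFDerivAt.fun_sum (u := Finset.univ) (fun σ _ => hterm σ)
  simp only [Matrix.det_apply', ]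
  refine hsum.congr_fderiv ?_
  ext v
  simp only [sum_apply, smul_apply, smul_eq_mul,
    Finset.mul_sum]
  rw [Finset.sum_comm]
  conv_rhs => rw [Finset.sum_comm]
  refine Finset.sum_congr rfl fun i _ => ?_
  have h1 : ∑ j, (A x).adjugate i j * A' j i v =
      ((A x).updateCol i (fun j => A' j i v)).det := by
    rw [← Matrix.cramer_apply, Matrix.cramer_eq_adjugate_mulVec]
    rfl
  rw [h1, Matrix.det_apply']
  refine Finset.sum_congr rfl fun σ _ => ?_
  rw [← Finset.mul_prod_erase Finset.univ _ (Finset.mem_univ i), Matrix.updateCol_self]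
  have h2 : ∏ k ∈ Finset.univ.erase i, (A x).updateCol i (fun j => A' j i v) (σ k) k =
      ∏ k ∈ Finset.univ.erase i, A x (σ k) k :=
    Finset.prod_congr rfl fun k hk => Matrix.updateCol_ne (Finset.ne_of_mem_erase hk)
  rw [h2]
  ring

theorem ContDiffAt.matrix_det {E m : Type*} [NormedAddCommGroup E] [NormedSpace ℝ E]
    [Fintype m] [DecidableEq m] {A : E → Matrix m m ℝ} {x : E} {k : WithTop ℕ∞}
    (hA : ∀ i j, ContDiffAt ℝ k (fun z => A z i j) x) :
    ContDiffAt ℝ k (fun z => (A z).det) x := by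
  simp only [Matrix.det_apply']
  exact ContDiffAt.sum fun σ _ => contDiffAt_const.mul (contDiffAt_prod fun i _ => hA _ _)

theorem ContDiffAt.matrix_inv_apply {E m : Type*} [NormedAddCommGroup E] [NormedSpace ℝ E]
    [Fintype m] [DecidableEq m] {A : E → Matrix m m ℝ} {x : E} {k : WithTop ℕ∞}
    (hA : ∀ i j, ContDiffAt ℝ k (fun z => A z i j) x) (hx : (A x).det ≠ 0) (i j : m) :
    ContDiffAt ℝ k (fun z => (A z)⁻¹ i j) x := by
  simp only [Matrix.inv_def, Ring.inverse_eq_inv', Matrix.smul_apply, smul_eq_mul,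
    Matrix.adjugate_apply]
  refine ((ContDiffAt.matrix_det hA).inv hx).mul (ContDiffAt.matrix_det fun p q => ?_)
  by_cases hp : p = j
  · subst hp
    simpa only [Matrix.updateRow_self] using contDiffAt_const
  · simpa only [Matrix.updateRow_ne hp] using hA p q

theorem Matrix.PosDef.inv_mul_self {m : Type*} [Fintype m] [DecidableEq m] {A : Matrix m m ℝ}
    (hA : A.PosDef) : A⁻¹ * A = 1 :=
  Matrix.nonsing_inv_mul A (isUnit_iff_ne_zero.2 hA.det_pos.ne')

theorem Matrix.PosDef.mul_inv_self {m : Type*} [Fintype m] [DecidableEq m] {A : Matrix m m ℝ}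
    (hA : A.PosDef) : A * A⁻¹ = 1 :=
  Matrix.mul_nonsing_inv A (isUnit_iff_ne_zero.2 hA.det_pos.ne')

/-! ### Hessian metrics -/

section Hessian

variable {n : ℕ} {D : Set (Fin n → ℝ)} {φ : (Fin n → ℝ) → ℝ} {x : Fin n → ℝ}

theorem Filter.EventuallyEq.euclGrad_eq {u v : (Fin n → ℝ) → ℝ}
    (h : u =ᶠ[nhds x] v) : euclGrad u x = euclGrad v x := by
  funext i
  simp only [euclGrad, h.fderiv_eq]

theorem ContDiffAt.euclGrad_apply {u : (Fin n → ℝ) → ℝ} (hu : ContDiffAt ℝ ∞ u x) (i : Fin n) :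
    ContDiffAt ℝ ∞ (fun z => euclGrad u z i) x :=
  (hu.fderiv_right (m := ∞) (by norm_num)).clm_apply contDiffAt_const

theorem ContDiffAt.hessian_apply {u : (Fin n → ℝ) → ℝ} (hu : ContDiffAt ℝ ∞ u x) (i j : Fin n) :
    ContDiffAt ℝ ∞ (fun z => hessian u z i j) x :=
  (hu.euclGrad_apply j).euclGrad_apply i

theorem ContDiffAt.fderiv_fderiv_apply {u : (Fin n → ℝ) → ℝ} (hu : ContDiffAt ℝ ∞ u x)
    (v w : Fin n → ℝ) :
    fderiv ℝ (fun z => fderiv ℝ u z v) x w = fderiv ℝ (fderiv ℝ u) x w v := by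
  have h : DifferentiableAt ℝ (fderiv ℝ u) x :=
    (hu.fderiv_right (m := ∞) (by norm_num)).differentiableAt (by norm_num)
  rw [fderiv_clm_apply h (differentiableAt_const v)]
  simp

theorem hessian_symm {u : (Fin n → ℝ) → ℝ} (hu : ContDiffAt ℝ ∞ u x) (i j : Fin n) :
    hessian u x i j = hessian u x j i := by
  simp only [hessian, Matrix.of_apply, euclGrad]
  rw [hu.fderiv_fderiv_apply, hu.fderiv_fderiv_apply]
  exact (hu.isSymmSndFDerivAt (by simpa using (WithTop.coe_le_coe.2 le_top : ((2 : ℕ∞) : WithTop ℕ∞) ≤ ∞))).eq _ _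

/-- A smooth function on an open set with positive definite Hessian: the potential of a Hessian
metric. -/
structure IsHessianPotential (D : Set (Fin n → ℝ)) (φ : (Fin n → ℝ) → ℝ) : Prop where
  isOpen : IsOpen D
  smooth : ContDiffOn ℝ ∞ φ D
  posDef : ∀ x ∈ D, (hessian φ x).PosDef

/-- The divergence `∑ⱼ ∂ⱼ Hⱼₖ` of the columns of the inverse Hessian `H`. -/
noncomputable def invHessianDiv (φ : (Fin n → ℝ) → ℝ) (x : Fin n → ℝ) (k : Fin n) : ℝ :=
  ∑ j, euclGrad (fun z => (hessian φ z)⁻¹ j k) x j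

namespace IsHessianPotential

variable (h : IsHessianPotential D φ) (hx : x ∈ D)
include h hx

theorem contDiffAt : ContDiffAt ℝ ∞ φ x := h.smooth.contDiffAt (h.isOpen.mem_nhds hx)

theorem contDiffAt_inv (i j : Fin n) : ContDiffAt ℝ ∞ (fun z => (hessian φ z)⁻¹ i j) x :=
  ContDiffAt.matrix_inv_apply (h.contDiffAt hx).hessian_apply (h.posDef x hx).det_pos.ne' i j

theorem inv_symm (i j : Fin n) : (hessian φ x)⁻¹ i j = (hessian φ x)⁻¹ j i := by
  have := (h.posDef x hx).isHermitian.inv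
  simpa using (this.apply i j).symm

theorem sum_mul_inv (i j : Fin n) :
    ∑ k, hessian φ x i k * (hessian φ x)⁻¹ k j = if i = j then 1 else 0 := by
  rw [← Matrix.mul_apply, (h.posDef x hx).mul_inv_self, Matrix.one_apply]

/-- The third derivatives of the potential are symmetric. -/
theorem euclGrad_hessian_comm (i j k : Fin n) :
    euclGrad (fun z => hessian φ z i j) x k = euclGrad (fun z => hessian φ z k j) x i :=
  hessian_symm ((h.contDiffAt hx).euclGrad_apply j) k i

theorem euclGrad_hessian_symm (i j k : Fin n) :
    euclGrad (fun z => hessian φ z i j) x k = euclGrad (fun z => hessian φ z j i) x k := by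
  refine congrFun (Filter.EventuallyEq.euclGrad_eq ?_) k
  filter_upwards [h.isOpen.mem_nhds hx] with z hz
  exact hessian_symm (h.contDiffAt hz) i j

/-- `∂ₖ H = - H (∂ₖ G) H` for the Hessian `G` and its inverse `H`. -/
theorem euclGrad_inv (i l k : Fin n) :
    euclGrad (fun z => (hessian φ z)⁻¹ i l) x k =
      -∑ a, ∑ b, (hessian φ x)⁻¹ i a * euclGrad (fun z => hessian φ z a b) x k *
        (hessian φ x)⁻¹ b l := by
  have hG := fun a b => ((h.contDiffAt hx).hessian_apply a b).differentiableAt (by norm_num)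
  have hH := fun a b => (h.contDiffAt_inv hx a b).differentiableAt (by norm_num)
  set e : Fin n → ℝ := Pi.single k 1
  set G' : Matrix (Fin n) (Fin n) ℝ :=
    Matrix.of fun a b => euclGrad (fun z => hessian φ z a b) x k with hG'
  set H' : Matrix (Fin n) (Fin n) ℝ :=
    Matrix.of fun a b => euclGrad (fun z => (hessian φ z)⁻¹ a b) x k with hH'
  have key : hessian φ x * H' + G' * (hessian φ x)⁻¹ = 0 := by
    ext a c
    have h1 : fderiv ℝ (fun z => ∑ b, hessian φ z a b * (hessian φ z)⁻¹ b c) x e = 0 := by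
      have : (fun z => ∑ b, hessian φ z a b * (hessian φ z)⁻¹ b c) =ᶠ[nhds x]
          fun _ => if a = c then 1 else 0 := by
        filter_upwards [h.isOpen.mem_nhds hx] with z hz
        exact h.sum_mul_inv hz a c
      rw [this.fderiv_eq]
      simp
    rw [fderiv_fun_sum fun b _ => (hG a b).fun_mul (hH b c)] at h1
    simp only [sum_apply, fderiv_fun_mul (hG _ _) (hH _ _), add_apply, smul_apply,
      smul_eq_mul, Finset.sum_add_distrib] at h1
    simp only [Matrix.add_apply, Matrix.mul_apply, hG', hH', Matrix.of_apply, euclGrad,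
      Matrix.zero_apply]
    rw [← h1]
    congr 1
    exact Finset.sum_congr rfl fun b _ => mul_comm _ _
  have h2 : H' = -((hessian φ x)⁻¹ * G' * (hessian φ x)⁻¹) := by
    have h3 := congrArg ((hessian φ x)⁻¹ * ·) key
    simp only [Matrix.mul_add, ← Matrix.mul_assoc, (h.posDef x hx).inv_mul_self, Matrix.one_mul,
      Matrix.mul_zero] at h3
    exact eq_neg_of_add_eq_zero_left h3
  have h4 := congrFun (congrFun h2 i) l
  simp only [hH', Matrix.of_apply, Matrix.neg_apply, Matrix.mul_apply, Finset.sum_mul] at h4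
  rw [h4, Finset.sum_comm]
  rfl

theorem hasFDerivAt_log_det {c : ℝ} (hc : 0 < c) :
    HasFDerivAt (fun z => Real.log (c * ((hessian φ z)⁻¹).det))
      (-∑ i, ∑ j, (hessian φ x)⁻¹ j i • fderiv ℝ (fun z => hessian φ z i j) x) x := by
  have hG := fun a b =>
    (((h.contDiffAt hx).hessian_apply a b).differentiableAt (by norm_num)).hasFDerivAt
  have hd := ((hasFDerivAt_matrix_det hG).log (h.posDef x hx).det_pos.ne').const_sub (Real.log c)
  refine (hd.congr_of_eventuallyEq ?_).congr_fderiv ?_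
  · filter_upwards [h.isOpen.mem_nhds hx] with z hz
    have hp := (h.posDef z hz).det_pos
    rw [Matrix.det_nonsing_inv, Ring.inverse_eq_inv', Real.log_mul hc.ne' (inv_pos.2 hp).ne',
      Real.log_inv, sub_eq_add_neg]
  · simp only [Matrix.inv_def, Ring.inverse_eq_inv', Matrix.smul_apply, smul_eq_mul,
      Finset.smul_sum, smul_smul]

/-- `H ∇ log det H = div H`. Both sides contract the third derivatives of the potential twice
with `H`, in two different orders. -/
theorem sum_inv_mul_euclGrad_log_det {c : ℝ} (hc : 0 < c) (k : Fin n) :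
    ∑ j, (hessian φ x)⁻¹ k j * euclGrad (fun z => Real.log (c * ((hessian φ z)⁻¹).det)) x j =
      invHessianDiv φ x k := by
  have h1 : ∀ j, euclGrad (fun z => Real.log (c * ((hessian φ z)⁻¹).det)) x j =
      -∑ i, ∑ l, (hessian φ x)⁻¹ l i * euclGrad (fun z => hessian φ z i l) x j := by
    intro j
    rw [euclGrad, (h.hasFDerivAt_log_det hx hc).fderiv]
    simp [euclGrad]
  simp only [invHessianDiv, h1, h.euclGrad_inv hx, mul_neg, Finset.sum_neg_distrib,
    Finset.mul_sum]
  congr 1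
  refine (Finset.sum_congr rfl fun j _ => Finset.sum_comm).trans (Finset.sum_comm.trans ?_)
  refine Finset.sum_congr rfl fun l _ => Finset.sum_comm.trans ?_
  refine Finset.sum_congr rfl fun i _ => Finset.sum_congr rfl fun j _ => ?_
  rw [h.euclGrad_hessian_symm hx i l j, h.euclGrad_hessian_comm hx l i j,
    h.euclGrad_hessian_symm hx j i l, h.inv_symm hx k j]
  ring

theorem contDiffAt_invHessianDiv (k : Fin n) :
    ContDiffAt ℝ ∞ (fun x => invHessianDiv φ x k) x :=
  ContDiffAt.sum fun j _ => (h.contDiffAt_inv hx j k).euclGrad_apply j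

end IsHessianPotential

end Hessian

/-! ### The local model of a toric Kähler metric -/

section LocalModel

open Matrix

variable {n : ℕ}

/-- The action coordinates `x` of `y = (x, t)`. -/
abbrev actions (y : Coord n) : Fin n → ℝ := fun i => y (Sum.inl i)

/-- The angle coordinates `t` of `y = (x, t)`. -/
abbrev angles (y : Coord n) : Fin n → ℝ := fun i => y (Sum.inr i)

theorem ContinuousLinearMap.apply_eq_sum_actions_angles {F : Type*} [NormedAddCommGroup F]
    [NormedSpace ℝ F] (l : Coord n →L[ℝ] F) (v : Coord n) :
    l v = ∑ i, actions v i • l (Pi.single (Sum.inl i) 1) +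
      ∑ i, angles v i • l (Pi.single (Sum.inr i) 1) := by
  conv_lhs => rw [← Finset.univ_sum_single v, Fintype.sum_sum_type]
  simp only [map_add, map_sum, actions, angles]
  have h : ∀ i, l (Pi.single i (v i)) = v i • l (Pi.single i 1) := by
    intro i
    rw [← map_smul, ← Pi.single_smul, smul_eq_mul, mul_one]
  simp only [h]

theorem actions_elim (p q : Fin n → ℝ) : actions (Sum.elim p q) = p := rfl

theorem angles_elim (p q : Fin n → ℝ) : angles (Sum.elim p q) = q := rfl

theorem contDiff_actions : ContDiff ℝ ∞ (actions : Coord n → Fin n → ℝ) :=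
  contDiff_pi.2 fun i => contDiff_apply ℝ ℝ (Sum.inl i)

theorem hasFDerivAt_comp_actions {F : Type*} [NormedAddCommGroup F] [NormedSpace ℝ F]
    {f : (Fin n → ℝ) → F} {y : Coord n} (hf : DifferentiableAt ℝ f (actions y)) :
    HasFDerivAt (fun z : Coord n => f (actions z))
      ((fderiv ℝ f (actions y)).comp
        (ContinuousLinearMap.pi fun i => ContinuousLinearMap.proj (Sum.inl i))) y := by
  have h : HasFDerivAt (actions : Coord n → Fin n → ℝ)
      (ContinuousLinearMap.pi fun i => ContinuousLinearMap.proj (Sum.inl i)) y :=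
    (ContinuousLinearMap.pi fun i : Fin n =>
      (ContinuousLinearMap.proj (Sum.inl i) : Coord n →L[ℝ] ℝ)).hasFDerivAt
  exact hf.hasFDerivAt.comp y h

theorem fderiv_comp_actions {F : Type*} [NormedAddCommGroup F] [NormedSpace ℝ F]
    {f : (Fin n → ℝ) → F} {y : Coord n} (hf : DifferentiableAt ℝ f (actions y)) (v : Coord n) :
    fderiv ℝ (fun z : Coord n => f (actions z)) y v = fderiv ℝ f (actions y) (actions v) := by
  rw [(hasFDerivAt_comp_actions hf).fderiv]
  rfl

theorem actions_single_inl (i : Fin n) (c : ℝ) :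
    actions (Pi.single (Sum.inl i) c : Coord n) = Pi.single i c := by
  funext j
  simp [actions, Pi.single_apply]

theorem actions_single_inr (i : Fin n) (c : ℝ) :
    actions (Pi.single (Sum.inr i) c : Coord n) = 0 := by
  funext j
  simp [actions]

theorem angles_single_inl (i : Fin n) (c : ℝ) :
    angles (Pi.single (Sum.inl i) c : Coord n) = 0 := by
  funext j
  simp [angles]

theorem angles_single_inr (i : Fin n) (c : ℝ) :
    angles (Pi.single (Sum.inr i) c : Coord n) = Pi.single i c := by
  funext j
  simp [angles, Pi.single_apply]

theorem potentialMetric_eq (φ : (Fin n → ℝ) → ℝ) (y v w : Coord n) :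
    potentialMetric φ y v w = actions v ⬝ᵥ hessian φ (actions y) *ᵥ actions w +
      angles v ⬝ᵥ (hessian φ (actions y))⁻¹ *ᵥ angles w := by
  simp only [potentialMetric, dotProduct, mulVec, Finset.sum_add_distrib, Finset.mul_sum]
  congr 1 <;> exact Finset.sum_congr rfl fun i _ => Finset.sum_congr rfl fun j _ => by ring

/-- In action-angle coordinates on `D × ℝⁿ`, the metric `g` and the complex structure `J` are
those given by the potential `φ` on `D`, the Kähler form being `∑ⱼ dxⱼ ∧ dtⱼ`. -/
structure IsHessianKahler (D : Set (Fin n → ℝ)) (φ : (Fin n → ℝ) → ℝ)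
    (g : Coord n → Coord n →L[ℝ] Coord n →L[ℝ] ℝ) (J : Coord n → Coord n →L[ℝ] Coord n) :
    Prop extends IsHessianPotential D φ where
  metric_eq : ∀ y, actions y ∈ D → ∀ v w, g y v w = potentialMetric φ y v w
  form_eq : ∀ y, actions y ∈ D → ∀ v w, LocalKahler.kahlerForm g J y v w =
    ∑ j, (v (Sum.inl j) * w (Sum.inr j) - v (Sum.inr j) * w (Sum.inl j))

theorem eventually_actions_mem {D : Set (Fin n → ℝ)} (hD : IsOpen D) {y : Coord n}
    (hy : actions y ∈ D) : ∀ᶠ z in nhds y, actions z ∈ D :=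
  contDiff_actions.continuous.continuousAt.preimage_mem_nhds (hD.mem_nhds hy)

namespace IsHessianKahler

open LocalKahler

variable {D : Set (Fin n → ℝ)} {φ : (Fin n → ℝ) → ℝ}
  {g : Coord n → Coord n →L[ℝ] Coord n →L[ℝ] ℝ} {J : Coord n → Coord n →L[ℝ] Coord n}
  (h : IsHessianKahler D φ g J) {y : Coord n} (hy : actions y ∈ D)
include h hy

theorem metric_apply (v w : Coord n) :
    g y v w = actions v ⬝ᵥ hessian φ (actions y) *ᵥ actions w +
      angles v ⬝ᵥ (hessian φ (actions y))⁻¹ *ᵥ angles w := by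
  rw [h.metric_eq y hy, potentialMetric_eq]

theorem inv_mulVec_mulVec (w : Fin n → ℝ) :
    (hessian φ (actions y))⁻¹ *ᵥ hessian φ (actions y) *ᵥ w = w := by
  rw [mulVec_mulVec, (h.posDef _ hy).inv_mul_self, one_mulVec]

theorem mulVec_inv_mulVec (w : Fin n → ℝ) :
    hessian φ (actions y) *ᵥ (hessian φ (actions y))⁻¹ *ᵥ w = w := by
  rw [mulVec_mulVec, (h.posDef _ hy).mul_inv_self, one_mulVec]

theorem inv_mulVec_dotProduct (v w : Fin n → ℝ) :
    (hessian φ (actions y))⁻¹ *ᵥ v ⬝ᵥ w = v ⬝ᵥ (hessian φ (actions y))⁻¹ *ᵥ w := by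
  rw [dotProduct_mulVec, ← mulVec_transpose]
  congr 2
  ext i j
  exact h.inv_symm hy i j

theorem mulVec_dotProduct (v w : Fin n → ℝ) :
    hessian φ (actions y) *ᵥ v ⬝ᵥ w = v ⬝ᵥ hessian φ (actions y) *ᵥ w := by
  rw [dotProduct_mulVec, ← mulVec_transpose]
  congr 2
  ext i j
  exact hessian_symm (h.contDiffAt hy) i j

/-- The Riesz vector of a covector for the metric. -/
theorem metric_riesz (l : Coord n →L[ℝ] ℝ) :
    g y (Sum.elim
      ((hessian φ (actions y))⁻¹ *ᵥ fun i => l (Pi.single (Sum.inl i) 1))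
      (hessian φ (actions y) *ᵥ fun i => l (Pi.single (Sum.inr i) 1))) = l := by
  ext1 w
  rw [h.metric_apply hy, l.apply_eq_sum_actions_angles w, actions_elim, angles_elim]
  congr 1
  · rw [h.inv_mulVec_dotProduct hy, h.inv_mulVec_mulVec hy]
    exact Finset.sum_congr rfl fun i _ => mul_comm _ _
  · rw [h.mulVec_dotProduct hy, h.mulVec_inv_mulVec hy]
    exact Finset.sum_congr rfl fun i _ => mul_comm _ _

theorem metric_bijective : Function.Bijective (g y) := by
  refine ⟨(injective_iff_map_eq_zero _).2 fun v hv => ?_, fun l => ⟨_, h.metric_riesz hy l⟩⟩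
  have key : ∀ w, g y w v = 0 := by
    intro w
    have := congrArg (fun l : Coord n →L[ℝ] ℝ => l w) hv
    simp only [_root_.zero_apply] at this
    rw [h.metric_apply hy] at this ⊢
    rwa [← h.mulVec_dotProduct hy, ← h.inv_mulVec_dotProduct hy, dotProduct_comm,
      dotProduct_comm _ (angles w)] at this
  funext i
  have h1 := h.metric_riesz hy (ContinuousLinearMap.proj i)
  simpa [key] using (congrArg (fun l : Coord n →L[ℝ] ℝ => l v) h1).symm

theorem grad_eq (u : Coord n → ℝ) :
    grad g u y = Sum.elim
      ((hessian φ (actions y))⁻¹ *ᵥ fun i => pd u (Sum.inl i) y)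
      (hessian φ (actions y) *ᵥ fun i => pd u (Sum.inr i) y) :=
  ContinuousLinearMap.inverse_apply_eq_of_bijective (h.metric_bijective hy)
    (h.metric_riesz hy (fderiv ℝ u y))

/-- `J` is determined by the metric and the Kähler form: `J ∂/∂xⱼ = ∑ₖ Gⱼₖ ∂/∂tₖ` and
`J ∂/∂tⱼ = - ∑ₖ Hⱼₖ ∂/∂xₖ`. -/
theorem J_apply (v : Coord n) :
    J y v = Sum.elim (-((hessian φ (actions y))⁻¹ *ᵥ angles v))
      (hessian φ (actions y) *ᵥ actions v) := by
  apply (h.metric_bijective hy).1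
  ext1 w
  have h1 := h.form_eq y hy v w
  simp only [kahlerForm, ContinuousLinearMap.comp_apply] at h1
  rw [h1, h.metric_apply hy, actions_elim, angles_elim, neg_dotProduct]
  have h2 := h.inv_mulVec_dotProduct hy (angles v) (hessian φ (actions y) *ᵥ actions w)
  have h3 := h.mulVec_dotProduct hy (actions v) ((hessian φ (actions y))⁻¹ *ᵥ angles w)
  rw [h.inv_mulVec_mulVec hy] at h2
  rw [h.mulVec_inv_mulVec hy] at h3
  rw [h3, h2]
  simp only [dotProduct, actions, angles, Finset.sum_sub_distrib]
  ring

theorem symplGrad_eq (u : Coord n → ℝ) :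
    symplGrad (kahlerForm g J) u y = Sum.elim (fun i => -pd u (Sum.inr i) y)
      (fun i => pd u (Sum.inl i) y) := by
  refine ContinuousLinearMap.inverse_apply_eq_of_bijective ⟨?_, fun l => ⟨Sum.elim
    (fun i => l (Pi.single (Sum.inr i) 1)) (fun i => -l (Pi.single (Sum.inl i) 1)), ?_⟩⟩ ?_
  · refine (injective_iff_map_eq_zero _).2 fun v hv => ?_
    have key : ∀ w, kahlerForm g J y v w = 0 := fun w => by rw [hv]; rfl
    funext i
    rcases i with i | i
    · have := key (Pi.single (Sum.inr i) 1)
      rw [h.form_eq y hy] at this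
      simpa [Pi.single_apply] using this
    · have := key (Pi.single (Sum.inl i) 1)
      rw [h.form_eq y hy] at this
      simpa [Pi.single_apply] using this
  · ext1 w
    rw [h.form_eq y hy, l.apply_eq_sum_actions_angles w, Finset.sum_sub_distrib]
    simp only [Sum.elim_inl, Sum.elim_inr, neg_mul, Finset.sum_neg_distrib, smul_eq_mul]
    simp only [actions, angles, mul_comm]
    ring
  · ext1 w
    rw [h.form_eq y hy, ContinuousLinearMap.apply_eq_sum_actions_angles _ w,
      Finset.sum_sub_distrib]
    simp only [Sum.elim_inl, Sum.elim_inr, neg_mul, Finset.sum_neg_distrib, smul_eq_mul,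
      _root_.neg_apply, pd, mul_neg]
    simp only [actions, angles, mul_comm]
    ring

theorem gram_eq :
    LocalKahler.gram g y = fromBlocks (hessian φ (actions y)) 0 0 (hessian φ (actions y))⁻¹ := by
  ext i j
  rw [LocalKahler.gram, of_apply, h.metric_apply hy]
  rcases i with i | i <;> rcases j with j | j <;>
    simp [actions_single_inl, actions_single_inr, angles_single_inl, angles_single_inr]

theorem det_gram : (LocalKahler.gram g y).det = 1 := by
  rw [h.gram_eq hy, det_fromBlocks_zero₂₁, ← det_mul, (h.posDef _ hy).mul_inv_self, det_one]

theorem gram_inv :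
    (LocalKahler.gram g y)⁻¹ = fromBlocks (hessian φ (actions y))⁻¹ 0 0 (hessian φ (actions y)) := by
  refine inv_eq_left_inv ?_
  rw [h.gram_eq hy, fromBlocks_multiply]
  simp [(h.posDef _ hy).mul_inv_self, (h.posDef _ hy).inv_mul_self]

/-- In action-angle coordinates the Riemannian volume is the Lebesgue measure, and the Laplacian
is `- ∂ₓ (H ∂ₓ) - ∂ₜ (G ∂ₜ)`. -/
theorem laplacian_eq (u : Coord n → ℝ) :
    laplacian g u y =
      -(∑ i, pd (fun z => ∑ j, (hessian φ (actions z))⁻¹ i j * pd u (Sum.inl j) z)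
          (Sum.inl i) y +
        ∑ i, pd (fun z => ∑ j, hessian φ (actions z) i j * pd u (Sum.inr j) z)
          (Sum.inr i) y) := by
  rw [laplacian, h.det_gram hy, Fintype.sum_sum_type]
  simp only [Real.sqrt_one, inv_one, neg_mul, one_mul]
  congr 2
  · refine Finset.sum_congr rfl fun i _ => ?_
    rw [pd, pd]
    refine congrFun (congrArg _ (Filter.EventuallyEq.fderiv_eq ?_)) _
    filter_upwards [eventually_actions_mem h.isOpen hy] with z hz
    rw [h.det_gram hz, h.gram_inv hz]
    simp [Fintype.sum_sum_type]
  · refine Finset.sum_congr rfl fun i _ => ?_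
    rw [pd, pd]
    refine congrFun (congrArg _ (Filter.EventuallyEq.fderiv_eq ?_)) _
    filter_upwards [eventually_actions_mem h.isOpen hy] with z hz
    rw [h.det_gram hz, h.gram_inv hz]
    simp [Fintype.sum_sum_type]

end IsHessianKahler

end LocalModel

/-! ### Holomorphic coordinates and the soliton equation -/

section HolomorphicCoordinates

open Matrix

variable {n : ℕ}

theorem ContinuousLinearMap.apply_eq_sum_single {ι F : Type*} [Fintype ι] [DecidableEq ι]
    [NormedAddCommGroup F] [NormedSpace ℝ F] (l : (ι → ℝ) →L[ℝ] F) (v : ι → ℝ) :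
    l v = ∑ i, v i • l (Pi.single i 1) := by
  conv_lhs => rw [← Finset.univ_sum_single v, map_sum]
  refine Finset.sum_congr rfl fun i _ => ?_
  rw [← map_smul, ← Pi.single_smul, smul_eq_mul, mul_one]

theorem fderiv_euclGrad {φ : (Fin n → ℝ) → ℝ} {x : Fin n → ℝ} (hφ : ContDiffAt ℝ ∞ φ x)
    (v : Fin n → ℝ) (k : Fin n) :
    fderiv ℝ (fun z => euclGrad φ z k) x v = (hessian φ x *ᵥ v) k := by
  rw [ContinuousLinearMap.apply_eq_sum_single]
  refine Finset.sum_congr rfl fun i _ => ?_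
  rw [smul_eq_mul, mul_comm]
  exact congrArg (· * _) (hessian_symm hφ i k)

theorem contDiffAt_logCoord {φ : (Fin n → ℝ) → ℝ} {y : Coord n}
    (hφ : ContDiffAt ℝ ∞ φ (actions y)) : ContDiffAt ℝ ∞ (logCoord φ) y := by
  refine contDiffAt_pi.2 fun k => ContDiffAt.add ?_ (contDiffAt_const.mul ?_)
  · exact (Complex.ofRealCLM.contDiff.contDiffAt).comp y
      ((hφ.euclGrad_apply k).comp y contDiff_actions.contDiffAt)
  · exact (Complex.ofRealCLM.contDiff.comp (contDiff_apply ℝ ℝ (Sum.inr k))).contDiffAt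

theorem fderiv_logCoord {φ : (Fin n → ℝ) → ℝ} {y : Coord n}
    (hφ : ContDiffAt ℝ ∞ φ (actions y)) (v : Coord n) (k : Fin n) :
    fderiv ℝ (logCoord φ) y v k =
      ((hessian φ (actions y) *ᵥ actions v) k : ℂ) + I * (angles v k : ℂ) := by
  have hd := (hφ.euclGrad_apply k).differentiableAt (by norm_num)
  have h1 := (Complex.ofRealCLM.hasFDerivAt).comp y (hasFDerivAt_comp_actions hd)
  have h2 := ((Complex.ofRealCLM.hasFDerivAt).comp y
    (ContinuousLinearMap.proj (R := ℝ) (φ := fun _ : Fin n ⊕ Fin n => ℝ)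
      (Sum.inr k)).hasFDerivAt).const_mul I
  have h3 : HasFDerivAt (fun z => logCoord φ z k) _ y := h1.add h2
  have h4 := (hasFDerivAt_pi'.1
    ((contDiffAt_logCoord hφ).differentiableAt (by norm_num)).hasFDerivAt k)
  have h5 := congrArg (fun l : Coord n →L[ℝ] ℂ => l v) (h4.unique h3)
  refine h5.trans ?_
  rw [← fderiv_euclGrad hφ]
  rfl

namespace IsHessianKahler

open LocalKahler

variable {D : Set (Fin n → ℝ)} {φ : (Fin n → ℝ) → ℝ}
  {g : Coord n → Coord n →L[ℝ] Coord n →L[ℝ] ℝ} {J : Coord n → Coord n →L[ℝ] Coord n}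
  (h : IsHessianKahler D φ g J) {y : Coord n} (hy : actions y ∈ D)
include h hy

/-- The vector with prescribed holomorphic coordinates. -/
theorem fderiv_logCoord_elim (w : Fin n → ℂ) :
    fderiv ℝ (logCoord φ) y (Sum.elim
      ((hessian φ (actions y))⁻¹ *ᵥ fun k => (w k).re) (fun k => (w k).im)) = w := by
  funext k
  rw [fderiv_logCoord (h.contDiffAt hy), actions_elim, angles_elim, h.mulVec_inv_mulVec hy,
    mul_comm]
  exact Complex.re_add_im (w k)

theorem fderiv_logCoord_bijective : Function.Bijective (fderiv ℝ (logCoord φ) y) := by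
  refine ⟨(injective_iff_map_eq_zero _).2 fun v hv => ?_, fun w =>
    ⟨_, h.fderiv_logCoord_elim hy w⟩⟩
  have h1 : ∀ k, (hessian φ (actions y) *ᵥ actions v) k = 0 ∧ angles v k = 0 := by
    intro k
    have := congrFun hv k
    rw [fderiv_logCoord (h.contDiffAt hy)] at this
    exact ⟨by simpa using congrArg Complex.re this, by simpa using congrArg Complex.im this⟩
  have h2 : actions v = 0 := by
    rw [← h.inv_mulVec_mulVec hy (actions v), funext fun k => (h1 k).1]
    exact mulVec_zero _
  funext i
  rcases i with i | i
  · exact congrFun h2 i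
  · exact (h1 i).2

theorem fderiv_logCoord_inverse (w : Fin n → ℂ) :
    (fderiv ℝ (logCoord φ) y).inverse w = Sum.elim
      ((hessian φ (actions y))⁻¹ *ᵥ fun k => (w k).re) (fun k => (w k).im) :=
  ContinuousLinearMap.inverse_apply_eq_of_bijective (h.fderiv_logCoord_bijective hy)
    (h.fderiv_logCoord_elim hy w)

theorem wirtinger_logCoord (k : Fin n) :
    wirtinger (logCoord φ) k y = Sum.elim (fun i => ((hessian φ (actions y))⁻¹ i k : ℂ) / 2)
      (fun i => if i = k then -I / 2 else 0) := by
  have h1 : (fun j => ((Pi.single k (1 : ℂ) : Fin n → ℂ) j).re) = Pi.single k 1 ∧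
      (fun j => ((Pi.single k (1 : ℂ) : Fin n → ℂ) j).im) = 0 ∧
      (fun j => ((Pi.single k I : Fin n → ℂ) j).re) = 0 ∧
      (fun j => ((Pi.single k I : Fin n → ℂ) j).im) = Pi.single k 1 := by
    refine ⟨?_, ?_, ?_, ?_⟩ <;> funext j <;> by_cases hj : j = k <;> simp [hj]
  funext i
  simp only [wirtinger, h.fderiv_logCoord_inverse hy]
  rcases i with i | i
  · simp only [Sum.elim_inl, h1.1, h1.2.2.1]
    simp
  · simp only [Sum.elim_inr, h1.2.1, h1.2.2.2]
    by_cases hi : i = k <;> simp [hi]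

theorem hermMatrix_eq :
    hermMatrix g (logCoord φ) y =
      Matrix.of fun j k => (((1 / 2 : ℝ) * (hessian φ (actions y))⁻¹ j k : ℝ) : ℂ) := by
  ext j k
  simp only [hermMatrix, of_apply, h.gram_eq hy, h.wirtinger_logCoord hy, Fintype.sum_sum_type,
    fromBlocks_apply₁₁, fromBlocks_apply₁₂, fromBlocks_apply₂₁, fromBlocks_apply₂₂,
    Sum.elim_inl, Sum.elim_inr, Matrix.zero_apply, Complex.ofReal_zero, zero_mul,
    Finset.sum_const_zero, add_zero, zero_add]
  have h1 : ∀ p, ∑ q, (hessian φ (actions y) p q : ℂ) * (((hessian φ (actions y))⁻¹ p j : ℂ) / 2) *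
      (starRingEnd ℂ) (((hessian φ (actions y))⁻¹ q k : ℂ) / 2) =
      ((hessian φ (actions y))⁻¹ p j : ℂ) / 4 * if p = k then 1 else 0 := by
    intro p
    have := congrArg (fun r : ℝ => (r : ℂ)) (h.sum_mul_inv hy p k)
    simp only [Complex.ofReal_sum, Complex.ofReal_mul] at this
    have h2 : ((if p = k then (1 : ℝ) else 0 : ℝ) : ℂ) = if p = k then 1 else 0 := by
      split_ifs <;> simp
    rw [← h2, ← this, Finset.mul_sum]
    refine Finset.sum_congr rfl fun q _ => ?_
    simp only [map_div₀, Complex.conj_ofReal, map_ofNat]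
    ring
  simp only [h1, apply_ite (starRingEnd ℂ), map_zero, mul_ite, ite_mul, mul_zero, zero_mul,
    mul_one, Finset.sum_ite_eq', Finset.mem_univ, if_true]
  rw [h.inv_symm hy k j]
  have h3 : (starRingEnd ℂ) (-I / 2) = I / 2 := by
    rw [map_div₀, map_neg, Complex.conj_I, map_ofNat, neg_neg]
  rw [h3]
  push_cast
  linear_combination -(((hessian φ (actions y))⁻¹ j k : ℂ) / 4) * Complex.I_mul_I

theorem log_det_hermMatrix :
    Real.log (hermMatrix g (logCoord φ) y).det.re =
      Real.log ((1 / 2) ^ n * ((hessian φ (actions y))⁻¹).det) := by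
  have h1 : hermMatrix g (logCoord φ) y =
      (Complex.ofRealHom.mapMatrix ((1 / 2 : ℝ) • (hessian φ (actions y))⁻¹)) := by
    rw [h.hermMatrix_eq hy]
    rfl
  rw [h1, ← RingHom.map_det, det_smul, Fintype.card_fin]
  rfl

/-- `dᶜ log det (g_{j k̄}) = ∑ₖ (div H)ₖ dtₖ`. -/
theorem dc_log_det :
    dc J (fun z => Real.log (hermMatrix g (logCoord φ) z).det.re) y =
      ∑ k, invHessianDiv φ (actions y) k • ContinuousLinearMap.proj (Sum.inr k) := by
  have h1 : (fun z => Real.log (hermMatrix g (logCoord φ) z).det.re) =ᶠ[nhds y]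
      fun z => Real.log ((1 / 2) ^ n * ((hessian φ (actions z))⁻¹).det) := by
    filter_upwards [eventually_actions_mem h.isOpen hy] with z hz
    exact h.log_det_hermMatrix hz
  have hc : (0 : ℝ) < (1 / 2) ^ n := by positivity
  have hd := (h.hasFDerivAt_log_det hy hc).differentiableAt
  ext1 v
  rw [dc, h1.fderiv_eq]
  simp only [_root_.neg_apply, ContinuousLinearMap.comp_apply, _root_.sum_apply,
    _root_.smul_apply, ContinuousLinearMap.proj_apply, smul_eq_mul]
  rw [fderiv_comp_actions (f := fun x => Real.log ((1 / 2) ^ n * ((hessian φ x)⁻¹).det)) hd,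
    h.J_apply hy, actions_elim, map_neg, neg_neg, ContinuousLinearMap.apply_eq_sum_single]
  simp only [← h.sum_inv_mul_euclGrad_log_det hy hc, mulVec, dotProduct, Finset.sum_mul,
    smul_eq_mul]
  rw [Finset.sum_comm]
  refine Finset.sum_congr rfl fun k _ => Finset.sum_congr rfl fun j _ => ?_
  rw [h.inv_symm hy j k, euclGrad]
  ring

theorem ricciForm_single (m k : Fin n) :
    ricciForm g J (logCoord φ) y (Pi.single (Sum.inl m) 1) (Pi.single (Sum.inr k) 1) =
      -(1 / 2) * euclGrad (fun x => invHessianDiv φ x k) (actions y) m := by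
  have h1 : dc J (fun z => Real.log (hermMatrix g (logCoord φ) z).det.re) =ᶠ[nhds y]
      fun z => ∑ k, invHessianDiv φ (actions z) k •
        (ContinuousLinearMap.proj (Sum.inr k) : Coord n →L[ℝ] ℝ) := by
    filter_upwards [eventually_actions_mem h.isOpen hy] with z hz
    exact h.dc_log_det hz
  have hd := fun k => (h.contDiffAt_invHessianDiv hy k).differentiableAt (by norm_num)
  have h2 := HasFDerivAt.fun_sum (u := Finset.univ) fun k _ =>
    (hasFDerivAt_comp_actions (hd k)).smul_const
      (ContinuousLinearMap.proj (Sum.inr k) : Coord n →L[ℝ] ℝ)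
  rw [ricciForm, ddc, h1.fderiv_eq, h2.fderiv]
  congr 1
  simp [Pi.single_apply, euclGrad]
  congr 1
  funext i
  simp [Pi.single_apply]

/-- The Lie derivative of the Kähler form along `- (H a) ∂ₓ`, the image under `J` of the
fundamental field `a ∂ₜ`. -/
theorem lieForm_single {W : Coord n → Coord n} {a : Fin n → ℝ}
    (hW : ∀ z, actions z ∈ D → W z = Sum.elim (-((hessian φ (actions z))⁻¹ *ᵥ a)) 0)
    (m k : Fin n) :
    lieForm W (kahlerForm g J) y (Pi.single (Sum.inl m) 1) (Pi.single (Sum.inr k) 1) =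
      -euclGrad (fun x => ((hessian φ x)⁻¹ *ᵥ a) k) (actions y) m := by
  have h0 : kahlerForm g J =ᶠ[nhds y] fun _ => kahlerForm g J y := by
    filter_upwards [eventually_actions_mem h.isOpen hy] with z hz
    ext1 v
    ext1 w
    rw [h.form_eq z hz, h.form_eq y hy]
  have hH : ∀ i, ContDiffAt ℝ ∞ (fun x => ((hessian φ x)⁻¹ *ᵥ a) i) (actions y) := fun i => by
    simp only [mulVec, dotProduct]
    exact ContDiffAt.sum fun j _ => (h.contDiffAt_inv hy i j).mul contDiffAt_const
  have hd : ∀ i, DifferentiableAt ℝ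
      (fun x => (Sum.elim (-((hessian φ x)⁻¹ *ᵥ a)) 0 : Coord n) i) (actions y) := by
    rintro (i | i)
    · exact ((hH i).differentiableAt (by norm_num)).neg
    · exact differentiableAt_const _
  have h1 : W =ᶠ[nhds y]
      fun z => (fun x => (Sum.elim (-((hessian φ x)⁻¹ *ᵥ a)) 0 : Coord n)) (actions z) := by
    filter_upwards [eventually_actions_mem h.isOpen hy] with z hz
    exact hW z hz
  have h2 : ∀ v i, fderiv ℝ W y v i =
      fderiv ℝ (fun x => (Sum.elim (-((hessian φ x)⁻¹ *ᵥ a)) 0 : Coord n) i) (actions y)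
        (actions v) := by
    intro v i
    rw [h1.fderiv_eq, fderiv_comp_actions (differentiableAt_pi.2 hd), fderiv_pi hd]
    rfl
  rw [lieForm, h0.fderiv_eq, h.form_eq y hy, h.form_eq y hy]
  simp only [h2, actions_single_inl, actions_single_inr, map_zero]
  simp [Pi.single_apply, euclGrad]

end IsHessianKahler

open LocalKahler in
/-- The soliton equation in action-angle coordinates says that the gradient of each component of
`- ½ div H + H a - x` vanishes. -/
theorem IsHessianKahler.exists_const_of_soliton {D : Set (Fin n → ℝ)} {φ : (Fin n → ℝ) → ℝ}
    {g : Coord n → Coord n →L[ℝ] Coord n →L[ℝ] ℝ} {J : Coord n → Coord n →L[ℝ] Coord n}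
    (h : IsHessianKahler D φ g J) (hD : IsPreconnected D) {W : Coord n → Coord n}
    {a : Fin n → ℝ}
    (hW : ∀ z, actions z ∈ D → W z = Sum.elim (-((hessian φ (actions z))⁻¹ *ᵥ a)) 0)
    (hs : ∀ y, actions y ∈ D → ∀ v w, ricciForm g J (logCoord φ) y v w - kahlerForm g J y v w =
      lieForm W (kahlerForm g J) y v w) (k : Fin n) :
    ∃ c, ∀ x ∈ D, -(1 / 2) * invHessianDiv φ x k + ((hessian φ x)⁻¹ *ᵥ a) k - x k = c := by
  have hH : ∀ x ∈ D, DifferentiableAt ℝ (fun x => ((hessian φ x)⁻¹ *ᵥ a) k) x := fun x hx => by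
    simp only [mulVec, dotProduct]
    exact DifferentiableAt.fun_sum fun j _ =>
      ((h.contDiffAt_inv hx k j).differentiableAt (by norm_num)).mul_const _
  have hdiv : ∀ x ∈ D, DifferentiableAt ℝ (fun x => invHessianDiv φ x k) x := fun x hx =>
    (h.contDiffAt_invHessianDiv hx k).differentiableAt (by norm_num)
  have hp : ∀ x : Fin n → ℝ, DifferentiableAt ℝ (fun x : Fin n → ℝ => x k) x := fun x =>
    differentiableAt_apply k x
  refine h.isOpen.exists_is_const_of_fderiv_eq_zero hD (fun x hx =>
    ((((hdiv x hx).const_mul _).add (hH x hx)).sub (hp x)).differentiableWithinAt)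
    fun x hx => ?_
  ext1 w
  rw [ContinuousLinearMap.apply_eq_sum_single]
  simp only [Pi.zero_apply, _root_.zero_apply]
  refine Finset.sum_eq_zero fun m _ => ?_
  have h1 := hs (Sum.elim x 0) hx (Pi.single (Sum.inl m) 1) (Pi.single (Sum.inr k) 1)
  rw [h.ricciForm_single hx, h.lieForm_single hx hW, h.form_eq _ hx, actions_elim, euclGrad,
    euclGrad] at h1
  rw [fderiv_fun_sub (((hdiv x hx).const_mul _).fun_add (hH x hx)) (hp x),
    fderiv_fun_add ((hdiv x hx).const_mul _) (hH x hx), fderiv_const_mul (hdiv x hx)]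
  have h2 : fderiv ℝ (fun x : Fin n → ℝ => x k) x (Pi.single m 1) =
      ∑ j, ((Pi.single (Sum.inl m) 1 : Coord n) (Sum.inl j) *
        (Pi.single (Sum.inr k) 1 : Coord n) (Sum.inr j) -
        (Pi.single (Sum.inl m) 1 : Coord n) (Sum.inr j) *
        (Pi.single (Sum.inr k) 1 : Coord n) (Sum.inl j)) := by
    rw [fderiv_apply differentiableAt_id k]
    simp [Pi.single_apply, eq_comm]
  simp only [_root_.sub_apply, _root_.add_apply, _root_.smul_apply, smul_eq_mul, h2]
  rw [mul_eq_zero]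
  right
  linarith

end HolomorphicCoordinates

/-! ### Gradients and weighted Laplacians of complex functions -/

section ComplexFunctions

open Matrix LocalKahler

variable {n : ℕ}

theorem LocalKahler.pd_re {v : Coord n → ℂ} {y : Coord n} (hv : DifferentiableAt ℝ v y)
    (i : Fin n ⊕ Fin n) : pd (fun z => (v z).re) i y = (fderiv ℝ v y (Pi.single i 1)).re := by
  have h := (Complex.reCLM.hasFDerivAt).comp y hv.hasFDerivAt
  exact congrArg (fun l : Coord n →L[ℝ] ℝ => l (Pi.single i 1)) h.fderiv

theorem LocalKahler.pd_im {v : Coord n → ℂ} {y : Coord n} (hv : DifferentiableAt ℝ v y)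
    (i : Fin n ⊕ Fin n) : pd (fun z => (v z).im) i y = (fderiv ℝ v y (Pi.single i 1)).im := by
  have h := (Complex.imCLM.hasFDerivAt).comp y hv.hasFDerivAt
  exact congrArg (fun l : Coord n →L[ℝ] ℝ => l (Pi.single i 1)) h.fderiv

namespace IsHessianKahler

variable {D : Set (Fin n → ℝ)} {φ : (Fin n → ℝ) → ℝ}
  {g : Coord n → Coord n →L[ℝ] Coord n →L[ℝ] ℝ} {J : Coord n → Coord n →L[ℝ] Coord n}
  (h : IsHessianKahler D φ g J) {y : Coord n} (hy : actions y ∈ D)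
include h hy

/-- `(∇_{g,J} v)^{1,0}` depends only on the `∂̄`-derivatives `½ (H ∂ₓ + i ∂ₜ) v`. -/
theorem part10_cgrad {v : Coord n → ℂ} (hv : DifferentiableAt ℝ v y) :
    part10 J y (cgrad g J v y) = Sum.elim
      (fun i => (∑ j, ((hessian φ (actions y))⁻¹ i j : ℂ) *
        fderiv ℝ v y (Pi.single (Sum.inl j) 1) + I * fderiv ℝ v y (Pi.single (Sum.inr i) 1)) / 2)
      (fun i => (∑ j, (hessian φ (actions y) i j : ℂ) *
        fderiv ℝ v y (Pi.single (Sum.inr j) 1) -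
          I * fderiv ℝ v y (Pi.single (Sum.inl i) 1)) / 2) := by
  have hc : cgrad g J v y = Sum.elim
      ((hessian φ (actions y))⁻¹ *ᵥ (fun i => (fderiv ℝ v y (Pi.single (Sum.inl i) 1)).re) -
        fun i => (fderiv ℝ v y (Pi.single (Sum.inr i) 1)).im)
      (hessian φ (actions y) *ᵥ (fun i => (fderiv ℝ v y (Pi.single (Sum.inr i) 1)).re) +
        fun i => (fderiv ℝ v y (Pi.single (Sum.inl i) 1)).im) := by
    rw [cgrad, h.grad_eq hy, h.grad_eq hy, h.J_apply hy, actions_elim, angles_elim,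
      h.mulVec_inv_mulVec hy, h.inv_mulVec_mulVec hy]
    simp only [pd_re hv, pd_im hv]
    funext i
    rcases i with i | i <;> simp [sub_eq_add_neg]
  have hJ : J y (cgrad g J v y) = Sum.elim
      (-((fun i => (fderiv ℝ v y (Pi.single (Sum.inr i) 1)).re) + (hessian φ (actions y))⁻¹ *ᵥ
        fun i => (fderiv ℝ v y (Pi.single (Sum.inl i) 1)).im))
      ((fun i => (fderiv ℝ v y (Pi.single (Sum.inl i) 1)).re) - hessian φ (actions y) *ᵥ
        fun i => (fderiv ℝ v y (Pi.single (Sum.inr i) 1)).im) := by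
    rw [h.J_apply hy, hc, actions_elim, angles_elim, mulVec_add, mulVec_sub,
      h.mulVec_inv_mulVec hy, h.inv_mulVec_mulVec hy]
  have hsplit : ∀ (A : Matrix (Fin n) (Fin n) ℝ) (w : Fin n → ℂ) (i : Fin n),
      ∑ j, (A i j : ℂ) * w j = ((A *ᵥ fun j => (w j).re) i : ℂ) +
        I * ((A *ᵥ fun j => (w j).im) i : ℂ) := by
    intro A w i
    simp only [mulVec, dotProduct, Complex.ofReal_sum, Complex.ofReal_mul, Finset.mul_sum,
      ← Finset.sum_add_distrib]
    refine Finset.sum_congr rfl fun j _ => ?_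
    conv_lhs => rw [← Complex.re_add_im (w j)]
    ring
  funext i
  rw [part10, hJ, hc]
  rcases i with i | i
  · simp only [Sum.elim_inl, Pi.sub_apply, Pi.add_apply, Pi.neg_apply]
    rw [hsplit _ (fun j => fderiv ℝ v y (Pi.single (Sum.inl j) 1))]
    conv_rhs => rw [← Complex.re_add_im (fderiv ℝ v y (Pi.single (Sum.inr i) 1))]
    push_cast
    linear_combination -(((fderiv ℝ v y (Pi.single (Sum.inr i) 1)).im : ℂ) / 2) * Complex.I_mul_I
  · simp only [Sum.elim_inr, Pi.sub_apply, Pi.add_apply]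
    rw [hsplit _ (fun j => fderiv ℝ v y (Pi.single (Sum.inr j) 1))]
    conv_rhs => rw [← Complex.re_add_im (fderiv ℝ v y (Pi.single (Sum.inl i) 1))]
    push_cast
    linear_combination (((fderiv ℝ v y (Pi.single (Sum.inl i) 1)).im : ℂ) / 2) * Complex.I_mul_I

/-- The weighted complex Laplacian in action-angle coordinates, for the weight `⟨x, 2a⟩`. -/
theorem complexLaplacian_eq {v : Coord n → ℂ} {w : Coord n → ℝ} {a : Fin n → ℝ}
    (hv : ∀ z, actions z ∈ D → ContDiffAt ℝ ∞ v z)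
    (hw : ∀ z, actions z ∈ D → w z = pairing (actions z) fun i => 2 * a i) :
    complexLaplacian g J w v y =
      -(∑ i, fderiv ℝ (fun z => ∑ j, ((hessian φ (actions z))⁻¹ i j : ℂ) *
            fderiv ℝ v z (Pi.single (Sum.inl j) 1)) y (Pi.single (Sum.inl i) 1) +
        ∑ i, fderiv ℝ (fun z => ∑ j, (hessian φ (actions z) i j : ℂ) *
            fderiv ℝ v z (Pi.single (Sum.inr j) 1)) y (Pi.single (Sum.inr i) 1)) +
      2 * ∑ i, (((hessian φ (actions y))⁻¹ *ᵥ a) i : ℂ) * fderiv ℝ v y (Pi.single (Sum.inl i) 1) -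
      2 * I * ∑ i, (a i : ℂ) * fderiv ℝ v y (Pi.single (Sum.inr i) 1) := by
  have hd : ∀ z, actions z ∈ D → DifferentiableAt ℝ v z := fun z hz =>
    (hv z hz).differentiableAt (by norm_num)
  have hdd : ∀ i, DifferentiableAt ℝ (fun z => fderiv ℝ v z (Pi.single i 1)) y := fun i =>
    (((hv y hy).fderiv_right (m := ∞) (by norm_num)).clm_apply
      contDiffAt_const).differentiableAt (by norm_num)
  have hcast : ∀ f : (Fin n → ℝ) → ℝ, ContDiffAt ℝ ∞ f (actions y) →
      DifferentiableAt ℝ (fun z => (f (actions z) : ℂ)) y := fun f hf =>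
    ((Complex.ofRealCLM.contDiff.contDiffAt).comp y
      (hf.comp y contDiff_actions.contDiffAt)).differentiableAt (by norm_num)
  have hA : ∀ i, DifferentiableAt ℝ (fun z => ∑ j, ((hessian φ (actions z))⁻¹ i j : ℂ) *
      fderiv ℝ v z (Pi.single (Sum.inl j) 1)) y := fun i =>
    DifferentiableAt.fun_sum fun j _ => (hcast _ (h.contDiffAt_inv hy i j)).mul (hdd _)
  have hB : ∀ i, DifferentiableAt ℝ (fun z => ∑ j, (hessian φ (actions z) i j : ℂ) *
      fderiv ℝ v z (Pi.single (Sum.inr j) 1)) y := fun i =>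
    DifferentiableAt.fun_sum fun j _ =>
      (hcast _ ((h.contDiffAt hy).hessian_apply i j)).mul (hdd _)
  have hev := eventually_actions_mem h.isOpen hy
  have hre : laplacian g (fun z => (v z).re) y =
      (-(∑ i, fderiv ℝ (fun z => ∑ j, ((hessian φ (actions z))⁻¹ i j : ℂ) *
            fderiv ℝ v z (Pi.single (Sum.inl j) 1)) y (Pi.single (Sum.inl i) 1) +
        ∑ i, fderiv ℝ (fun z => ∑ j, (hessian φ (actions z) i j : ℂ) *
            fderiv ℝ v z (Pi.single (Sum.inr j) 1)) y (Pi.single (Sum.inr i) 1))).re := by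
    rw [h.laplacian_eq hy, Complex.neg_re, Complex.add_re, Complex.re_sum, Complex.re_sum]
    congr 2 <;> refine Finset.sum_congr rfl fun i _ => ?_
    · rw [← pd_re (hA i), pd, pd]
      refine congrFun (congrArg _ (Filter.EventuallyEq.fderiv_eq ?_)) _
      filter_upwards [hev] with z hz
      simp [pd_re (hd z hz)]
    · rw [← pd_re (hB i), pd, pd]
      refine congrFun (congrArg _ (Filter.EventuallyEq.fderiv_eq ?_)) _
      filter_upwards [hev] with z hz
      simp [pd_re (hd z hz)]
  have him : laplacian g (fun z => (v z).im) y =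
      (-(∑ i, fderiv ℝ (fun z => ∑ j, ((hessian φ (actions z))⁻¹ i j : ℂ) *
            fderiv ℝ v z (Pi.single (Sum.inl j) 1)) y (Pi.single (Sum.inl i) 1) +
        ∑ i, fderiv ℝ (fun z => ∑ j, (hessian φ (actions z) i j : ℂ) *
            fderiv ℝ v z (Pi.single (Sum.inr j) 1)) y (Pi.single (Sum.inr i) 1))).im := by
    rw [h.laplacian_eq hy, Complex.neg_im, Complex.add_im, Complex.im_sum, Complex.im_sum]
    congr 2 <;> refine Finset.sum_congr rfl fun i _ => ?_
    · rw [← pd_im (hA i), pd, pd]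
      refine congrFun (congrArg _ (Filter.EventuallyEq.fderiv_eq ?_)) _
      filter_upwards [hev] with z hz
      simp [pd_im (hd z hz)]
    · rw [← pd_im (hB i), pd, pd]
      refine congrFun (congrArg _ (Filter.EventuallyEq.fderiv_eq ?_)) _
      filter_upwards [hev] with z hz
      simp [pd_im (hd z hz)]
  have hwe : w =ᶠ[nhds y] fun z => pairing (actions z) fun i => 2 * a i := by
    filter_upwards [hev] with z hz
    exact hw z hz
  have hp : ∀ u : Coord n, fderiv ℝ w y u = ∑ i, actions u i * (2 * a i) := by
    intro u
    have h1 : HasFDerivAt (fun z : Coord n => pairing (actions z) fun i => 2 * a i)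
        (∑ i, (2 * a i) • (ContinuousLinearMap.proj (Sum.inl i) : Coord n →L[ℝ] ℝ)) y :=
      HasFDerivAt.fun_sum fun i _ =>
        (ContinuousLinearMap.proj (R := ℝ) (φ := fun _ : Fin n ⊕ Fin n => ℝ)
          (Sum.inl i)).hasFDerivAt.mul_const (2 * a i)
    rw [hwe.fderiv_eq, h1.fderiv]
    simp [mul_comm]
  have hpl : ∀ i, pd w (Sum.inl i) y = 2 * a i := fun i => by
    rw [pd, hp, actions_single_inl]
    simp [Pi.single_apply]
  have hpr : ∀ i, pd w (Sum.inr i) y = 0 := fun i => by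
    rw [pd, hp, actions_single_inr]
    simp
  have hg : grad g w y = (2 : ℝ) • Sum.elim ((hessian φ (actions y))⁻¹ *ᵥ a) 0 := by
    rw [h.grad_eq hy]
    simp only [hpl, hpr]
    have h2 : (fun i => 2 * a i) = (2 : ℝ) • a := rfl
    have h3 : (fun _ : Fin n => (0 : ℝ)) = 0 := rfl
    rw [h2, h3, mulVec_smul, mulVec_zero]
    funext i
    rcases i with i | i <;> simp
  have hs : symplGrad (kahlerForm g J) w y = (2 : ℝ) • Sum.elim (0 : Fin n → ℝ) a := by
    rw [h.symplGrad_eq hy]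
    simp only [hpl, hpr]
    funext i
    rcases i with i | i <;> simp
  have hfre : ∀ u : Coord n, fderiv ℝ (fun z => (v z).re) y u = (fderiv ℝ v y u).re := fun u =>
    congrArg (fun l : Coord n →L[ℝ] ℝ => l u)
      ((Complex.reCLM.hasFDerivAt).comp y (hd y hy).hasFDerivAt).fderiv
  have hfim : ∀ u : Coord n, fderiv ℝ (fun z => (v z).im) y u = (fderiv ℝ v y u).im := fun u =>
    congrArg (fun l : Coord n →L[ℝ] ℝ => l u)
      ((Complex.imCLM.hasFDerivAt).comp y (hd y hy).hasFDerivAt).fderiv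
  have hv1 : 2 * ∑ i, (((hessian φ (actions y))⁻¹ *ᵥ a) i : ℂ) *
      fderiv ℝ v y (Pi.single (Sum.inl i) 1) = fderiv ℝ v y (grad g w y) := by
    rw [hg, map_smul, ContinuousLinearMap.apply_eq_sum_actions_angles]
    simp
  have hv2 : 2 * ∑ i, (a i : ℂ) * fderiv ℝ v y (Pi.single (Sum.inr i) 1) =
      fderiv ℝ v y (symplGrad (kahlerForm g J) w y) := by
    rw [hs, map_smul, ContinuousLinearMap.apply_eq_sum_actions_angles]
    simp
  rw [mul_right_comm, hv1, hv2]
  simp only [complexLaplacian, complexLaplacianReal, weightedLaplacian, bOperator, hre, him, hfre,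
    hfim, Complex.ofReal_add]
  generalize -(∑ i, fderiv ℝ (fun z => ∑ j, ((hessian φ (actions z))⁻¹ i j : ℂ) *
            fderiv ℝ v z (Pi.single (Sum.inl j) 1)) y (Pi.single (Sum.inl i) 1) +
        ∑ i, fderiv ℝ (fun z => ∑ j, (hessian φ (actions z) i j : ℂ) *
            fderiv ℝ v z (Pi.single (Sum.inr j) 1)) y (Pi.single (Sum.inr i) 1)) = X
  generalize fderiv ℝ v y (grad g w y) = Y
  generalize fderiv ℝ v y (symplGrad (kahlerForm g J) w y) = Z
  conv_rhs => rw [← Complex.re_add_im X, ← Complex.re_add_im Y, ← Complex.re_add_im Z]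
  ring

end IsHessianKahler

end ComplexFunctions

/-! ### Root functions and Demazure vector fields -/

section RootFunctions

open Matrix LocalKahler

variable {n : ℕ}

/-- The function `exp (- ⟨α, ∇φ + s t⟩)`: for `s = i` the monomial `τ^{-α}` in the coordinates of
the complex torus, for `s = -i` its complex conjugate. -/
noncomputable def monomial (φ : (Fin n → ℝ) → ℝ) (α : Fin n → ℤ) (s : ℂ) (y : Coord n) : ℂ :=
  exp (-∑ k, (α k : ℂ) * ((euclGrad φ (actions y) k : ℂ) + s * (angles y k : ℂ)))

theorem rootExpr_eq {ι : Type*} (b : ι → Fin n → ℤ) (φ : (Fin n → ℝ) → ℝ) (α : Fin n → ℤ) (ρ : ι)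
    (y : Coord n) : rootExpr b φ α ρ y = (facetFun b ρ (actions y) : ℂ) * monomial φ α I y := rfl

theorem conj_rootExpr {ι : Type*} (b : ι → Fin n → ℤ) (φ : (Fin n → ℝ) → ℝ) (α : Fin n → ℤ)
    (ρ : ι) (y : Coord n) : (starRingEnd ℂ) (rootExpr b φ α ρ y) =
      (facetFun b ρ (actions y) : ℂ) * monomial φ α (-I) y := by
  rw [rootExpr_eq, monomial, monomial, map_mul, Complex.conj_ofReal, ← Complex.exp_conj]
  simp

section Derivatives

variable {φ : (Fin n → ℝ) → ℝ} {y : Coord n} (hφ : ContDiffAt ℝ ∞ φ (actions y))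
  (α : Fin n → ℤ) (s : ℂ)
include hφ

theorem contDiffAt_monomial : ContDiffAt ℝ ∞ (monomial φ α s) y := by
  refine ContDiffAt.cexp (ContDiffAt.neg (ContDiffAt.sum fun k _ => contDiffAt_const.mul
    (ContDiffAt.add ?_ (contDiffAt_const.mul ?_))))
  · exact (Complex.ofRealCLM.contDiff.contDiffAt).comp y
      ((hφ.euclGrad_apply k).comp y contDiff_actions.contDiffAt)
  · exact (Complex.ofRealCLM.contDiff.comp (contDiff_apply ℝ ℝ (Sum.inr k))).contDiffAt

theorem fderiv_monomial (v : Coord n) :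
    fderiv ℝ (monomial φ α s) y v =
      -((∑ k, (α k : ℂ) * (((hessian φ (actions y) *ᵥ actions v) k : ℂ) +
        s * (angles v k : ℂ))) * monomial φ α s y) := by
  have hd := fun k => (hφ.euclGrad_apply k).differentiableAt (by norm_num : (∞ : WithTop ℕ∞) ≠ 0)
  have h1 := fun k => (Complex.ofRealCLM.hasFDerivAt).comp y (hasFDerivAt_comp_actions (hd k))
  have h2 := fun k : Fin n => ((Complex.ofRealCLM.hasFDerivAt).comp y
    (ContinuousLinearMap.proj (R := ℝ) (φ := fun _ : Fin n ⊕ Fin n => ℝ)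
      (Sum.inr k)).hasFDerivAt).const_mul s
  have h3 := (HasFDerivAt.fun_sum (u := Finset.univ)
    fun k _ => ((h1 k).add (h2 k)).const_mul (α k : ℂ)).neg.cexp
  have h4 : HasFDerivAt (monomial φ α s) _ y := h3
  rw [h4.fderiv]
  simp only [← fderiv_euclGrad hφ]
  simp only [_root_.smul_apply, _root_.neg_apply, _root_.sum_apply, _root_.add_apply, smul_eq_mul,
    ContinuousLinearMap.comp_apply]
  rw [mul_neg, mul_comm]
  rfl

variable {f : (Fin n → ℝ) → ℝ} (hf : DifferentiableAt ℝ f (actions y))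
include hf

theorem fderiv_mul_monomial (v : Coord n) :
    fderiv ℝ (fun z => (f (actions z) : ℂ) * monomial φ α s z) y v =
      ((fderiv ℝ f (actions y) (actions v) : ℂ) - (f (actions y) : ℂ) *
        ∑ k, (α k : ℂ) * (((hessian φ (actions y) *ᵥ actions v) k : ℂ) +
          s * (angles v k : ℂ))) * monomial φ α s y := by
  have h1 := (Complex.ofRealCLM.hasFDerivAt).comp y (hasFDerivAt_comp_actions hf)
  have h2 := ((contDiffAt_monomial hφ α s).differentiableAt (by norm_num)).hasFDerivAt
  have h3 := congrArg (fun l : Coord n →L[ℝ] ℂ => l v) (h1.mul h2).fderiv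
  refine h3.trans ?_
  simp only [_root_.smul_apply, _root_.add_apply, smul_eq_mul, fderiv_monomial hφ]
  simp only [ContinuousLinearMap.comp_apply, Function.comp_apply]
  have h4 : (ContinuousLinearMap.pi fun i => ContinuousLinearMap.proj (Sum.inl i) :
    Coord n →L[ℝ] Fin n → ℝ) v = actions v := rfl
  rw [h4]
  simp only [Complex.ofRealCLM_apply]
  ring

theorem fderiv_mul_monomial_inl (i : Fin n) :
    fderiv ℝ (fun z => (f (actions z) : ℂ) * monomial φ α s z) y (Pi.single (Sum.inl i) 1) =
      ((euclGrad f (actions y) i - f (actions y) *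
        (hessian φ (actions y) *ᵥ fun k => (α k : ℝ)) i : ℝ) : ℂ) * monomial φ α s y := by
  rw [fderiv_mul_monomial hφ α s hf, actions_single_inl, angles_single_inl]
  have h1 : ∑ k, (α k : ℂ) * (((hessian φ (actions y) *ᵥ Pi.single i 1) k : ℂ) +
      s * ((0 : Fin n → ℝ) k : ℂ)) =
      ((hessian φ (actions y) *ᵥ fun k => (α k : ℝ)) i : ℝ) := by
    have h2 : ∀ k, (hessian φ (actions y) *ᵥ Pi.single i 1) k = hessian φ (actions y) i k := by
      intro k
      rw [mulVec_single_one, hessian_symm hφ i k]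
      rfl
    simp only [h2]
    simp [mulVec, dotProduct, mul_comm]
  rw [h1, euclGrad]
  push_cast
  rfl

theorem fderiv_mul_monomial_inr (i : Fin n) :
    fderiv ℝ (fun z => (f (actions z) : ℂ) * monomial φ α s z) y (Pi.single (Sum.inr i) 1) =
      -s * (((f (actions y) * α i : ℝ) : ℂ) * monomial φ α s y) := by
  rw [fderiv_mul_monomial hφ α s hf, actions_single_inr, angles_single_inr]
  have h1 : ∀ k, ((Pi.single i (1 : ℝ) : Fin n → ℝ) k : ℂ) = if k = i then 1 else 0 := by
    intro k
    by_cases hk : k = i <;> simp [hk]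
  simp [h1]
  ring

end Derivatives

theorem contDiff_facetFun {ι : Type*} (b : ι → Fin n → ℤ) (ρ : ι) :
    ContDiff ℝ ∞ (facetFun b ρ) :=
  (ContDiff.sum fun i _ => (contDiff_apply ℝ ℝ i).mul contDiff_const).add contDiff_const

theorem hasFDerivAt_facetFun {ι : Type*} (b : ι → Fin n → ℤ) (σ : ι) (x : Fin n → ℝ) :
    HasFDerivAt (facetFun b σ)
      (∑ i, (b σ i : ℝ) • (ContinuousLinearMap.proj i : (Fin n → ℝ) →L[ℝ] ℝ)) x :=
  (HasFDerivAt.fun_sum fun i _ =>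
    (ContinuousLinearMap.proj (R := ℝ) (φ := fun _ : Fin n => ℝ)
      i).hasFDerivAt.mul_const (b σ i : ℝ)).add_const 1

theorem euclGrad_facetFun {ι : Type*} (b : ι → Fin n → ℤ) (ρ : ι) (x : Fin n → ℝ) (i : Fin n) :
    euclGrad (facetFun b ρ) x i = b ρ i := by
  rw [euclGrad, (hasFDerivAt_facetFun b ρ x).fderiv]
  simp [Pi.single_apply]

theorem contDiffAt_rootExpr {ι : Type*} {φ : (Fin n → ℝ) → ℝ} {y : Coord n}
    (hφ : ContDiffAt ℝ ∞ φ (actions y)) (b : ι → Fin n → ℤ) (α : Fin n → ℤ) (ρ : ι) :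
    ContDiffAt ℝ ∞ (rootExpr b φ α ρ) y :=
  ((Complex.ofRealCLM.contDiff.comp
    ((contDiff_facetFun b ρ).comp contDiff_actions)).contDiffAt).mul
      (contDiffAt_monomial hφ α I)

namespace IsHessianKahler

variable {D : Set (Fin n → ℝ)} {φ : (Fin n → ℝ) → ℝ}
  {g : Coord n → Coord n →L[ℝ] Coord n →L[ℝ] ℝ} {J : Coord n → Coord n →L[ℝ] Coord n}
  (h : IsHessianKahler D φ g J) {y : Coord n} (hy : actions y ∈ D)
include h hy

theorem wirtinger_torusCoord (k : Fin n) :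
    torusCoord φ y k • wirtinger (torusCoord φ) k y = wirtinger (logCoord φ) k y := by
  have hz := (contDiffAt_logCoord (h.contDiffAt hy)).differentiableAt (by norm_num)
  have hτ : ∀ v k, fderiv ℝ (torusCoord φ) y v k =
      torusCoord φ y k * fderiv ℝ (logCoord φ) y v k := by
    intro v k
    have h1 := hasFDerivAt_pi.2 fun k => (hasFDerivAt_pi'.1 hz.hasFDerivAt k).cexp
    have h2 : HasFDerivAt (torusCoord φ) _ y := h1
    rw [h2.fderiv]
    simp [torusCoord]
  have hne : ∀ k, torusCoord φ y k ≠ 0 := fun k => Complex.exp_ne_zero _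
  have hinv : ∀ w, (fderiv ℝ (torusCoord φ) y).inverse w =
      (fderiv ℝ (logCoord φ) y).inverse fun k => w k / torusCoord φ y k := by
    have hsol : ∀ w, fderiv ℝ (torusCoord φ) y
        ((fderiv ℝ (logCoord φ) y).inverse fun k => w k / torusCoord φ y k) = w := by
      intro w
      funext k
      rw [hτ, h.fderiv_logCoord_inverse hy, h.fderiv_logCoord_elim hy, mul_div_cancel₀ _ (hne k)]
    refine fun w => ContinuousLinearMap.inverse_apply_eq_of_bijective
      ⟨(injective_iff_map_eq_zero _).2 fun v hv => ?_, fun w => ⟨_, hsol w⟩⟩ (hsol w)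
    refine (injective_iff_map_eq_zero _).1 (h.fderiv_logCoord_bijective hy).1 v ?_
    funext k
    have := congrFun hv k
    rw [hτ] at this
    exact (mul_eq_zero.1 this).resolve_left (hne k)
  have hsingle : ∀ c : ℂ, (fun j => (Pi.single k c : Fin n → ℂ) j / torusCoord φ y j) =
      Pi.single k (c / torusCoord φ y k) := by
    intro c
    funext j
    by_cases hj : j = k
    · subst hj
      simp
    · simp [hj]
  have hre : ∀ c : ℂ, (fun j => ((Pi.single k c : Fin n → ℂ) j).re) = Pi.single k c.re := by
    intro c
    funext j
    by_cases hj : j = k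
    · subst hj
      simp
    · simp [hj]
  have him : ∀ c : ℂ, (fun j => ((Pi.single k c : Fin n → ℂ) j).im) = Pi.single k c.im := by
    intro c
    funext j
    by_cases hj : j = k
    · subst hj
      simp
    · simp [hj]
  rw [h.wirtinger_logCoord hy]
  have hdecomp : ∀ c : ℂ, (c.re : ℂ) - I * ((I * c).re : ℂ) = c ∧
      (c.im : ℂ) - I * ((I * c).im : ℂ) = -I * c := by
    intro c
    refine ⟨?_, ?_⟩ <;> apply Complex.ext <;> simp
  have hc := hdecomp (1 / torusCoord φ y k)
  rw [← mul_div_assoc, mul_one] at hc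
  funext i
  simp only [Pi.smul_apply, smul_eq_mul, wirtinger, hinv, h.fderiv_logCoord_inverse hy, hsingle,
    hre, him]
  rcases i with i | i
  · simp only [Sum.elim_inl, mulVec_single, Pi.smul_apply, MulOpposite.smul_eq_mul_unop,
      MulOpposite.unop_op, Complex.ofReal_mul]
    simp only [Matrix.col_apply]
    have h1 := hc.1
    have h2 := hne k
    rw [eq_div_iff h2] at h1
    linear_combination (((hessian φ (actions y))⁻¹ i k : ℂ) / 2) * h1
  · simp only [Sum.elim_inr]
    by_cases hi : i = k
    · subst hi
      simp only [Pi.single_eq_same, if_true, hc.2]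
      field_simp [hne i]
    · simp [hi]

theorem demazureField_eq (α β : Fin n → ℤ) :
    demazureField φ α β y = Sum.elim
      (fun i => (((hessian φ (actions y))⁻¹ *ᵥ fun k => (β k : ℝ)) i : ℂ) / 2 * monomial φ α I y)
      (fun i => -I * (β i : ℂ) / 2 * monomial φ α I y) := by
  have h1 : ∏ i, torusCoord φ y i ^ (-α i) = monomial φ α I y := by
    rw [monomial, ← Finset.sum_neg_distrib, Complex.exp_sum]
    refine Finset.prod_congr rfl fun i _ => ?_
    rw [torusCoord, ← Complex.exp_int_mul]
    simp [logCoord]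
  rw [demazureField, h1]
  simp only [mul_smul, h.wirtinger_torusCoord hy, h.wirtinger_logCoord hy]
  funext i
  simp only [Pi.smul_apply, Finset.sum_apply, smul_eq_mul]
  rcases i with i | i
  · simp only [Sum.elim_inl, mulVec, dotProduct, Complex.ofReal_sum, Complex.ofReal_mul,
      Finset.sum_div, Finset.mul_sum, Finset.sum_mul]
    refine Finset.sum_congr rfl fun k _ => ?_
    push_cast
    ring
  · simp only [Sum.elim_inr, mul_ite, mul_zero, Finset.sum_ite_eq, Finset.mem_univ, if_true]
    ring

theorem sum_inv_mul_fderiv_inl {ι : Type*} (b : ι → Fin n → ℤ) (α : Fin n → ℤ) (ρ : ι) (s : ℂ)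
    (i : Fin n) :
    ∑ j, ((hessian φ (actions y))⁻¹ i j : ℂ) * fderiv ℝ
      (fun z => (facetFun b ρ (actions z) : ℂ) * monomial φ α s z) y (Pi.single (Sum.inl j) 1) =
      ((((hessian φ (actions y))⁻¹ *ᵥ fun k => (b ρ k : ℝ)) i -
        facetFun b ρ (actions y) * α i : ℝ) : ℂ) * monomial φ α s y := by
  have hL : DifferentiableAt ℝ (facetFun b ρ) (actions y) :=
    (contDiff_facetFun b ρ).contDiffAt.differentiableAt (by norm_num)
  simp only [fderiv_mul_monomial_inl (h.contDiffAt hy) α s hL, euclGrad_facetFun]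
  have h2 : ∑ j, (hessian φ (actions y))⁻¹ i j *
      (hessian φ (actions y) *ᵥ fun k => (α k : ℝ)) j = α i :=
    congrFun (h.inv_mulVec_mulVec hy fun k => (α k : ℝ)) i
  have h3 : ((hessian φ (actions y))⁻¹ *ᵥ fun k => (b ρ k : ℝ)) i =
      ∑ j, (hessian φ (actions y))⁻¹ i j * b ρ j := rfl
  rw [← h2, h3, Finset.mul_sum, ← Finset.sum_sub_distrib, Complex.ofReal_sum, Finset.sum_mul]
  refine Finset.sum_congr rfl fun j _ => ?_
  push_cast
  ring

theorem sum_mul_fderiv_inr {ι : Type*} (b : ι → Fin n → ℤ) (α : Fin n → ℤ) (ρ : ι) (s : ℂ)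
    (i : Fin n) :
    ∑ j, (hessian φ (actions y) i j : ℂ) * fderiv ℝ
      (fun z => (facetFun b ρ (actions z) : ℂ) * monomial φ α s z) y (Pi.single (Sum.inr j) 1) =
      -s * (((facetFun b ρ (actions y) *
        (hessian φ (actions y) *ᵥ fun k => (α k : ℝ)) i : ℝ) : ℂ) * monomial φ α s y) := by
  have hL : DifferentiableAt ℝ (facetFun b ρ) (actions y) :=
    (contDiff_facetFun b ρ).contDiffAt.differentiableAt (by norm_num)
  simp only [fderiv_mul_monomial_inr (h.contDiffAt hy) α s hL]
  rw [mulVec, dotProduct, Finset.mul_sum, Complex.ofReal_sum, Finset.sum_mul, Finset.mul_sum]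
  refine Finset.sum_congr rfl fun j _ => ?_
  push_cast
  ring

/-- The complex gradient of the root function is the Demazure field. -/
theorem part10_cgrad_rootExpr {ι : Type*} (b : ι → Fin n → ℤ) (α : Fin n → ℤ) (ρ : ι) :
    part10 J y (cgrad g J (rootExpr b φ α ρ) y) = demazureField φ α (b ρ) y := by
  have hφ := h.contDiffAt hy
  have hL : DifferentiableAt ℝ (facetFun b ρ) (actions y) :=
    (contDiff_facetFun b ρ).contDiffAt.differentiableAt (by norm_num)
  rw [h.part10_cgrad hy ((contDiffAt_rootExpr hφ b α ρ).differentiableAt (by norm_num)),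
    h.demazureField_eq hy]
  have h0 : rootExpr b φ α ρ = fun z => (facetFun b ρ (actions z) : ℂ) * monomial φ α I z := rfl
  rw [h0]
  simp only [h.sum_inv_mul_fderiv_inl hy, h.sum_mul_fderiv_inr hy]
  simp only [fderiv_mul_monomial_inl hφ α I hL, fderiv_mul_monomial_inr hφ α I hL, euclGrad_facetFun]
  funext i
  rcases i with i | i
  · simp only [Sum.elim_inl]
    push_cast
    linear_combination (-(facetFun b ρ (actions y) : ℂ) * α i * monomial φ α I y / 2) *
      Complex.I_mul_I
  · simp only [Sum.elim_inr]
    push_cast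
    ring

/-- If `-½ div H + H a - x` is orthogonal to the facet normal `b_ρ`, then the conjugate of the
root function is an eigenfunction of the weighted complex Laplacian, with eigenvalue `2`. -/
theorem complexLaplacian_conj_rootExpr {ι : Type*} (b : ι → Fin n → ℤ) (α : Fin n → ℤ) (ρ : ι)
    {w : Coord n → ℝ} {a : Fin n → ℝ}
    (hw : ∀ z, actions z ∈ D → w z = pairing (actions z) fun i => 2 * a i)
    (hα : ∑ i, α i * b ρ i = 1)
    (hkey : ∑ k, (-(1 / 2) * invHessianDiv φ (actions y) k +
      ((hessian φ (actions y))⁻¹ *ᵥ a) k - y (Sum.inl k)) * (b ρ k : ℝ) = 0) :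
    complexLaplacian g J w (fun z => (starRingEnd ℂ) (rootExpr b φ α ρ z)) y =
      2 * (starRingEnd ℂ) (rootExpr b φ α ρ y) := by
  have hφ := h.contDiffAt hy
  have hLd : DifferentiableAt ℝ (facetFun b ρ) (actions y) :=
    (contDiff_facetFun b ρ).contDiffAt.differentiableAt (by norm_num)
  have hev := eventually_actions_mem h.isOpen hy
  simp only [conj_rootExpr]
  rw [h.complexLaplacian_eq hy (fun z hz => ?_) hw]
  swap
  · exact ((Complex.ofRealCLM.contDiff.comp
      ((contDiff_facetFun b ρ).comp contDiff_actions)).contDiffAt).mul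
        (contDiffAt_monomial (h.contDiffAt hz) α (-I))
  set L := facetFun b ρ (actions y) with hLdef
  set Ga : Fin n → ℝ := hessian φ (actions y) *ᵥ fun k => (α k : ℝ) with hGa
  set Hb : Fin n → ℝ := (hessian φ (actions y))⁻¹ *ᵥ fun k => (b ρ k : ℝ) with hHb
  set m := monomial φ α (-I) y with hm
  have hHd : ∀ i k, DifferentiableAt ℝ (fun x => (hessian φ x)⁻¹ i k) (actions y) := fun i k =>
    (h.contDiffAt_inv hy i k).differentiableAt (by norm_num)
  have hf1 : ∀ i, DifferentiableAt ℝ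
      (fun x => ((hessian φ x)⁻¹ *ᵥ fun k => (b ρ k : ℝ)) i) (actions y) := fun i => by
    simp only [mulVec, dotProduct]
    exact DifferentiableAt.fun_sum fun k _ => (hHd i k).mul_const _
  have hf : ∀ i, DifferentiableAt ℝ (fun x => ((hessian φ x)⁻¹ *ᵥ fun k => (b ρ k : ℝ)) i -
      facetFun b ρ x * α i) (actions y) := fun i => (hf1 i).sub (hLd.mul_const _)
  have hfgrad : ∀ i, euclGrad (fun x => ((hessian φ x)⁻¹ *ᵥ fun k => (b ρ k : ℝ)) i -
      facetFun b ρ x * α i) (actions y) i =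
      ∑ k, euclGrad (fun x => (hessian φ x)⁻¹ i k) (actions y) i * b ρ k - b ρ i * α i := by
    intro i
    have h1 : fderiv ℝ (fun x => ((hessian φ x)⁻¹ *ᵥ fun k => (b ρ k : ℝ)) i) (actions y)
        (Pi.single i 1) =
        ∑ k, euclGrad (fun x => (hessian φ x)⁻¹ i k) (actions y) i * b ρ k := by
      simp only [mulVec, dotProduct]
      rw [fderiv_fun_sum fun k _ => (hHd i k).mul_const _]
      rw [_root_.sum_apply]
      refine Finset.sum_congr rfl fun k _ => ?_
      rw [fderiv_mul_const (hHd i k), _root_.smul_apply, smul_eq_mul, mul_comm, euclGrad]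
    rw [euclGrad, fderiv_fun_sub (hf1 i) (hLd.mul_const _), _root_.sub_apply, h1,
      fderiv_mul_const hLd, _root_.smul_apply, smul_eq_mul, mul_comm (α i : ℝ)]
    exact congrArg (fun r => _ - r * _) (euclGrad_facetFun b ρ _ i)
  have hg : ∀ i, DifferentiableAt ℝ (fun x => facetFun b ρ x *
      (hessian φ x *ᵥ fun k => (α k : ℝ)) i) (actions y) := fun i => by
    refine hLd.mul ?_
    simp only [mulVec, dotProduct]
    exact DifferentiableAt.fun_sum fun k _ =>
      ((hφ.hessian_apply i k).differentiableAt (by norm_num)).mul_const _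
  have hS1 : ∀ i, fderiv ℝ (fun z => ∑ j, ((hessian φ (actions z))⁻¹ i j : ℂ) *
      fderiv ℝ (fun z => (facetFun b ρ (actions z) : ℂ) * monomial φ α (-I) z) z
        (Pi.single (Sum.inl j) 1)) y (Pi.single (Sum.inl i) 1) =
      ((∑ k, euclGrad (fun x => (hessian φ x)⁻¹ i k) (actions y) i * b ρ k - b ρ i * α i -
        (Hb i - L * α i) * Ga i : ℝ) : ℂ) * m := by
    intro i
    have h1 : (fun z => ∑ j, ((hessian φ (actions z))⁻¹ i j : ℂ) *
      fderiv ℝ (fun z => (facetFun b ρ (actions z) : ℂ) * monomial φ α (-I) z) z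
        (Pi.single (Sum.inl j) 1)) =ᶠ[nhds y] fun z =>
        (((fun x => ((hessian φ x)⁻¹ *ᵥ fun k => (b ρ k : ℝ)) i -
          facetFun b ρ x * α i) (actions z) : ℝ) : ℂ) * monomial φ α (-I) z := by
      filter_upwards [hev] with z hz
      exact h.sum_inv_mul_fderiv_inl hz b α ρ (-I) i
    rw [h1.fderiv_eq, fderiv_mul_monomial_inl hφ α (-I) (hf i), hfgrad]
  have hS2 : ∀ i, fderiv ℝ (fun z => ∑ j, (hessian φ (actions z) i j : ℂ) *
      fderiv ℝ (fun z => (facetFun b ρ (actions z) : ℂ) * monomial φ α (-I) z) z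
        (Pi.single (Sum.inr j) 1)) y (Pi.single (Sum.inr i) 1) =
      -(((L * Ga i * α i : ℝ) : ℂ) * m) := by
    intro i
    have h1 : (fun z => ∑ j, (hessian φ (actions z) i j : ℂ) *
      fderiv ℝ (fun z => (facetFun b ρ (actions z) : ℂ) * monomial φ α (-I) z) z
        (Pi.single (Sum.inr j) 1)) =ᶠ[nhds y] fun z => I *
        ((((fun x => facetFun b ρ x * (hessian φ x *ᵥ fun k => (α k : ℝ)) i) (actions z) : ℝ) : ℂ)
          * monomial φ α (-I) z) := by
      filter_upwards [hev] with z hz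
      rw [h.sum_mul_fderiv_inr hz b α ρ (-I) i, neg_neg]
    have hd : DifferentiableAt ℝ (fun z => ((((fun x => facetFun b ρ x *
        (hessian φ x *ᵥ fun k => (α k : ℝ)) i) (actions z) : ℝ) : ℂ)
          * monomial φ α (-I) z)) y :=
      (Complex.ofRealCLM.differentiableAt.comp y
        (hasFDerivAt_comp_actions (hg i)).differentiableAt).mul
        ((contDiffAt_monomial hφ α (-I)).differentiableAt (by norm_num))
    rw [h1.fderiv_eq, fderiv_const_mul hd, _root_.smul_apply,
      fderiv_mul_monomial_inr hφ α (-I) (hg i), neg_neg, smul_eq_mul, ← mul_assoc,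
      Complex.I_mul_I, neg_one_mul]
  simp only [hS1, hS2, fderiv_mul_monomial_inl hφ α (-I) hLd,
    fderiv_mul_monomial_inr hφ α (-I) hLd, neg_neg, euclGrad_facetFun]
  -- All terms are real multiples of `m`; what remains is an identity between these multiples.
  have hreal : -(∑ i, (∑ k, euclGrad (fun x => (hessian φ x)⁻¹ i k) (actions y) i * b ρ k -
        b ρ i * α i - (Hb i - L * α i) * Ga i) - ∑ i, L * Ga i * α i) +
      2 * ∑ i, ((hessian φ (actions y))⁻¹ *ᵥ a) i * (b ρ i - L * Ga i) +
      2 * ∑ i, a i * (L * α i) = 2 * L := by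
    have hα' : ∑ i, (b ρ i : ℝ) * α i = 1 := by
      simp only [mul_comm (b ρ _ : ℝ)]
      exact_mod_cast hα
    have e1 : ∑ i, Hb i * Ga i = 1 := by
      rw [← hα']
      refine (h.inv_mulVec_dotProduct hy (fun k => (b ρ k : ℝ)) Ga).trans ?_
      rw [hGa, h.inv_mulVec_mulVec hy]
      rfl
    have e2 : ∑ i, ((hessian φ (actions y))⁻¹ *ᵥ a) i * Ga i = ∑ i, a i * α i := by
      refine (h.inv_mulVec_dotProduct hy a Ga).trans ?_
      rw [hGa, h.inv_mulVec_mulVec hy]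
      rfl
    have e3 : ∑ i, ∑ k, euclGrad (fun x => (hessian φ x)⁻¹ i k) (actions y) i * b ρ k =
        ∑ k, invHessianDiv φ (actions y) k * b ρ k := by
      rw [Finset.sum_comm]
      simp only [invHessianDiv, Finset.sum_mul]
    have e4 : ∑ k, y (Sum.inl k) * (b ρ k : ℝ) = L - 1 := by
      rw [hLdef, facetFun, pairing]
      ring
    have e5 : ∑ i, (Hb i - L * α i) * Ga i = 1 - ∑ i, L * Ga i * α i := by
      rw [← e1, ← Finset.sum_sub_distrib]
      exact Finset.sum_congr rfl fun i _ => by ring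
    have e6 : ∑ i, ((hessian φ (actions y))⁻¹ *ᵥ a) i * (b ρ i - L * Ga i) =
        ∑ i, ((hessian φ (actions y))⁻¹ *ᵥ a) i * b ρ i - L * ∑ i, a i * α i := by
      rw [← e2, Finset.mul_sum, ← Finset.sum_sub_distrib]
      exact Finset.sum_congr rfl fun i _ => by ring
    have e7 : ∑ i, a i * (L * α i) = L * ∑ i, a i * α i := by
      rw [Finset.mul_sum]
      exact Finset.sum_congr rfl fun i _ => by ring
    have e8 : -(1 / 2) * ∑ k, invHessianDiv φ (actions y) k * b ρ k +
        ∑ i, ((hessian φ (actions y))⁻¹ *ᵥ a) i * b ρ i - (L - 1) = 0 := by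
      rw [← e4, Finset.mul_sum, ← Finset.sum_add_distrib, ← Finset.sum_sub_distrib, ← hkey]
      exact Finset.sum_congr rfl fun i _ => by ring
    rw [Finset.sum_sub_distrib, Finset.sum_sub_distrib, e3, hα', e5, e6, e7]
    linear_combination 2 * e8
  have c1 : ∀ r : Fin n → ℝ, ∑ i, (r i : ℂ) * m = ((∑ i, r i : ℝ) : ℂ) * m := fun r => by
    rw [Complex.ofReal_sum, Finset.sum_mul]
  have c2 : ∀ p r : Fin n → ℝ, ∑ i, (p i : ℂ) * ((r i : ℂ) * m) =
      ((∑ i, p i * r i : ℝ) : ℂ) * m := fun p r => by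
    rw [← c1]
    exact Finset.sum_congr rfl fun i _ => by push_cast; ring
  have c3 : ∀ p r : Fin n → ℝ, ∑ i, (p i : ℂ) * (I * ((r i : ℂ) * m)) =
      I * (((∑ i, p i * r i : ℝ) : ℂ) * m) := fun p r => by
    rw [← c2, Finset.mul_sum]
    exact Finset.sum_congr rfl fun i _ => by ring
  rw [Finset.sum_neg_distrib, c1, c1, c2, c3]
  have hfin := congrArg (fun r : ℝ => (r : ℂ) * m) hreal
  simp only [Complex.ofReal_add, Complex.ofReal_neg, Complex.ofReal_sub, Complex.ofReal_mul,
    Complex.ofReal_ofNat] at hfin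
  generalize hX : (∑ i, a i * (L * α i) : ℝ) = X at hfin ⊢
  linear_combination hfin - 2 * (X : ℂ) * m * Complex.I_mul_I

end IsHessianKahler

end RootFunctions

/-! ### Strictly convex functions on relatively open subsets of a hyperplane -/

section Convexity

open Matrix

/-- A strictly convex function lies strictly above its tangent hyperplanes. -/
theorem StrictConvexOn.add_fderiv_lt {E : Type*} [NormedAddCommGroup E] [NormedSpace ℝ E]
    {F : Set E} {S : E → ℝ} (hS : StrictConvexOn ℝ F S) {x y : E} (hx : x ∈ F) (hy : y ∈ F)
    (hxy : x ≠ y) (hd : DifferentiableAt ℝ S x) : S x + fderiv ℝ S x (y - x) < S y := by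
  have weak : ∀ z ∈ F, S x + fderiv ℝ S x (z - x) ≤ S z := by
    intro z hz
    have h1 := hS.convexOn.comp_affineMap (AffineMap.lineMap x z : ℝ →ᵃ[ℝ] E)
    have h2 : HasDerivAt (S ∘ (AffineMap.lineMap x z : ℝ →ᵃ[ℝ] E)) (fderiv ℝ S x (z - x)) 0 := by
      refine HasFDerivAt.comp_hasDerivAt (f := AffineMap.lineMap x z) 0 ?_
        AffineMap.hasDerivAt_lineMap
      simpa using hd.hasFDerivAt
    have h3 := h1.le_slope_of_hasDerivAt (x := 0) (y := 1) (by simpa using hx) (by simpa using hz)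
      zero_lt_one h2
    simp [slope] at h3
    rw [map_sub]
    linarith
  have hm := hS.1 hx hy (by norm_num : (0 : ℝ) ≤ 1 / 2) (by norm_num : (0 : ℝ) ≤ 1 / 2)
    (by norm_num)
  have h1 := weak _ hm
  have h2 := hS.2 hx hy hxy (by norm_num : (0 : ℝ) < 1 / 2) (by norm_num : (0 : ℝ) < 1 / 2)
    (by norm_num)
  have h3 : (1 / 2 : ℝ) • x + (1 / 2 : ℝ) • y - x = (1 / 2 : ℝ) • (y - x) := by
    module
  rw [h3, map_smul] at h1
  simp only [smul_eq_mul] at h1 h2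
  linarith

theorem IsLocalMin.deriv_deriv_nonneg {f : ℝ → ℝ} {s : ℝ} (hf : IsLocalMin f s)
    (hc : ContinuousAt f s) : 0 ≤ deriv (deriv f) s := by
  by_contra! hneg
  have hmax := isLocalMax_of_deriv_deriv_neg hneg hf.deriv_eq_zero hc
  have hconst : f =ᶠ[nhds s] fun _ => f s := by
    filter_upwards [hf, hmax] with t h1 h2
    exact le_antisymm h2 h1
  have h1 := hconst.deriv.deriv_eq
  simp only [deriv_const', deriv_const] at h1
  exact hneg.ne h1

variable {n : ℕ}

theorem le_hessian_of_isLocalMin {u : (Fin n → ℝ) → ℝ} {x v : Fin n → ℝ}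
    (hu : ContDiffAt ℝ ∞ u x) {c d : ℝ}
    (hmin : IsLocalMin (fun s : ℝ => u (x + s • v) + (c * s - d * s ^ 2)) 0) :
    2 * d ≤ v ⬝ᵥ hessian u x *ᵥ v := by
  have hline : ∀ s : ℝ, HasDerivAt (fun s : ℝ => x + s • v) v s := fun s => by
    simpa using ((hasDerivAt_id s).smul_const v).const_add x
  have hx0 : x + (0 : ℝ) • v = x := by simp
  have hcont : ContinuousAt (fun s : ℝ => x + s • v) 0 := (hline 0).continuousAt
  obtain ⟨O, hO, hxO, hOu⟩ : ∃ O : Set (Fin n → ℝ), IsOpen O ∧ x ∈ O ∧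
      ∀ z ∈ O, DifferentiableAt ℝ u z := by
    have h1 : ∀ᶠ z in nhds x, ContDiffAt ℝ 1 u z :=
      (hu.of_le (by exact_mod_cast le_top)).eventually (by simp)
    obtain ⟨O, h2, h3, h4⟩ := eventually_nhds_iff.1 h1
    exact ⟨O, h3, h4, fun z hz => (h2 z hz).differentiableAt (by norm_num)⟩
  have hev : ∀ᶠ s : ℝ in nhds 0, x + s • v ∈ O :=
    hcont.preimage_mem_nhds (by rw [hx0]; exact hO.mem_nhds hxO)
  have hpoly : ∀ s : ℝ, HasDerivAt (fun s : ℝ => c * s - d * s ^ 2) (c - d * (2 * s)) s :=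
    fun s => by
      simpa using ((hasDerivAt_id s).const_mul c).fun_sub ((hasDerivAt_pow 2 s).const_mul d)
  have hd1 : deriv (fun s : ℝ => u (x + s • v) + (c * s - d * s ^ 2)) =ᶠ[nhds 0]
      fun s => fderiv ℝ u (x + s • v) v + (c - d * (2 * s)) := by
    filter_upwards [hev] with s hs
    exact ((((hOu _ hs).hasFDerivAt).comp_hasDerivAt s (hline s)).add (hpoly s)).deriv
  have hd2 : HasDerivAt (fun s : ℝ => fderiv ℝ u (x + s • v) v + (c - d * (2 * s)))
      (fderiv ℝ (fderiv ℝ u) x v v + -(d * 2)) 0 := by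
    have h1 : HasFDerivAt (fderiv ℝ u) (fderiv ℝ (fderiv ℝ u) x) (x + (0 : ℝ) • v) := by
      rw [hx0]
      exact ((hu.fderiv_right (m := ∞) (by norm_num)).differentiableAt (by norm_num)).hasFDerivAt
    have h2 : HasDerivAt (fun s : ℝ => fderiv ℝ u (x + s • v)) (fderiv ℝ (fderiv ℝ u) x v) 0 :=
      h1.comp_hasDerivAt (0 : ℝ) (hline 0)
    have h3 := h2.clm_apply (hasDerivAt_const (0 : ℝ) v)
    rw [map_zero, add_zero] at h3
    have h4 := (((hasDerivAt_id (0 : ℝ)).const_mul 2).const_mul d).const_sub c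
    rw [mul_one] at h4
    exact h3.add h4
  have hnonneg := hmin.deriv_deriv_nonneg (by
    refine ContinuousAt.add ?_ (hpoly 0).continuousAt
    refine ContinuousAt.comp (f := fun s : ℝ => x + s • v) ?_ hcont
    rw [hx0]
    exact hu.continuousAt)
  rw [hd1.deriv_eq, hd2.deriv] at hnonneg
  have hH : fderiv ℝ (fderiv ℝ u) x v v = v ⬝ᵥ hessian u x *ᵥ v := by
    rw [← hu.fderiv_fderiv_apply, ContinuousLinearMap.apply_eq_sum_single]
    refine Finset.sum_congr rfl fun i _ => ?_
    rw [smul_eq_mul, hu.fderiv_fderiv_apply, ContinuousLinearMap.apply_eq_sum_single]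
    congr 1
    refine Finset.sum_congr rfl fun j _ => ?_
    rw [smul_eq_mul, ← hu.fderiv_fderiv_apply, mul_comm]
    rfl
  rw [hH] at hnonneg
  linarith

/-- The Hessian of a smooth strictly convex function on a relatively open subset `F` of a
hyperplane may degenerate, but not at every point of `F`: subtract from the function its tangent
at some point and a small multiple of the squared distance to that point; the result has an
interior minimum on a small ball. -/
theorem StrictConvexOn.exists_hessian_pos {S : (Fin n → ℝ) → ℝ} {F O : Set (Fin n → ℝ)}
    {β x₀ : Fin n → ℝ} (hF : StrictConvexOn ℝ F S) (hx₀ : x₀ ∈ F)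
    (hS : ∀ x ∈ F, ContDiffAt ℝ ∞ S x) (hO : IsOpen O)
    (hFO : ∀ x, x ∈ F ↔ x ∈ O ∧ x ⬝ᵥ β = x₀ ⬝ᵥ β) :
    ∃ x ∈ F, ∃ ε > 0, ∀ v, v ⬝ᵥ β = 0 → ε * (v ⬝ᵥ v) ≤ v ⬝ᵥ hessian S x *ᵥ v := by
  obtain ⟨r, hr, hball⟩ := Metric.nhds_basis_closedBall.mem_iff.1
    (hO.mem_nhds ((hFO x₀).1 hx₀).1)
  have hsq : ∀ x : Fin n → ℝ, (x - x₀) ⬝ᵥ (x - x₀) ≤ r ^ 2 → x ∈ Metric.closedBall x₀ r := by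
    intro x hx
    refine (dist_pi_le_iff hr.le).2 fun i => ?_
    rw [Real.dist_eq]
    refine abs_le_of_sq_le_sq ?_ hr.le
    refine le_trans ?_ hx
    have := Finset.single_le_sum (f := fun i => (x - x₀) i * (x - x₀) i)
      (fun j _ => mul_self_nonneg _) (Finset.mem_univ i)
    simpa only [sq, Pi.sub_apply, dotProduct] using this
  have hcq : Continuous fun x : Fin n → ℝ => (x - x₀) ⬝ᵥ (x - x₀) := by
    simp only [dotProduct]
    fun_prop
  have hcβ : Continuous fun x : Fin n → ℝ => x ⬝ᵥ β := by
    simp only [dotProduct]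
    fun_prop
  set K : Set (Fin n → ℝ) := {x | x ⬝ᵥ β = x₀ ⬝ᵥ β ∧ (x - x₀) ⬝ᵥ (x - x₀) ≤ r ^ 2} with hK
  have hKF : K ⊆ F := fun x hx => (hFO x).2 ⟨hball (hsq x hx.2), hx.1⟩
  have hKc : IsCompact K := by
    refine (isCompact_closedBall x₀ r).of_isClosed_subset ?_ fun x hx => hsq x hx.2
    exact (isClosed_eq hcβ continuous_const).inter (isClosed_le hcq continuous_const)
  have hx₀K : x₀ ∈ K := ⟨rfl, by simp [sq_nonneg]⟩
  set f : (Fin n → ℝ) → ℝ := fun x => S x - S x₀ - fderiv ℝ S x₀ (x - x₀) with hf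
  have hfc : ContinuousOn f K := fun x hx =>
    (((hS x (hKF hx)).continuousAt.sub continuousAt_const).sub
      (by fun_prop)).continuousWithinAt
  have hfpos : ∀ x ∈ F, x ≠ x₀ → 0 < f x := fun x hx hne => by
    have := hF.add_fderiv_lt hx₀ hx hne.symm ((hS x₀ hx₀).differentiableAt (by norm_num))
    simp only [hf]
    linarith
  obtain ⟨m, hm, hmf⟩ : ∃ m > 0, ∀ x ∈ K, (x - x₀) ⬝ᵥ (x - x₀) = r ^ 2 → m ≤ f x := by
    have hK' : IsCompact (K ∩ {x | (x - x₀) ⬝ᵥ (x - x₀) = r ^ 2}) :=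
      hKc.inter_right (isClosed_eq hcq continuous_const)
    rcases (K ∩ {x | (x - x₀) ⬝ᵥ (x - x₀) = r ^ 2}).eq_empty_or_nonempty with he | hne
    · refine ⟨1, one_pos, fun x hx hxr => ?_⟩
      have : x ∈ K ∩ {x | (x - x₀) ⬝ᵥ (x - x₀) = r ^ 2} := ⟨hx, hxr⟩
      rw [he] at this
      exact this.elim
    · obtain ⟨z, hz, hzmin⟩ := hK'.exists_isMinOn hne (hfc.mono inter_subset_left)
      refine ⟨f z, hfpos z (hKF hz.1) ?_, fun x hx hxr => hzmin ⟨hx, hxr⟩⟩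
      rintro rfl
      have := hz.2
      simp only [mem_ofPred_eq, sub_self, dotProduct_zero] at this
      exact (pow_pos hr 2).ne this
  set ε := m / (2 * r ^ 2) with hε
  have hεpos : 0 < ε := by positivity
  obtain ⟨z, hz, hzmin⟩ := hKc.exists_isMinOn ⟨x₀, hx₀K⟩
    (hfc.sub (hcq.continuousOn.const_mul ε))
  have hz0 : f z - ε * ((z - x₀) ⬝ᵥ (z - x₀)) ≤ 0 := by
    have := hzmin hx₀K
    simpa [hf] using this
  have hzlt : (z - x₀) ⬝ᵥ (z - x₀) < r ^ 2 := by
    refine lt_of_le_of_ne hz.2 fun heq => ?_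
    have h1 := hmf z hz heq
    rw [heq, hε] at hz0
    have h2 : m / (2 * r ^ 2) * r ^ 2 = m / 2 := by
      field_simp
    linarith
  refine ⟨z, hKF hz, 2 * ε, by positivity, fun v hv => ?_⟩
  have hcl : Continuous fun s : ℝ => z + s • v := by fun_prop
  have hmin : IsLocalMin (fun s : ℝ => S (z + s • v) +
      ((-fderiv ℝ S x₀ v - 2 * ε * ((z - x₀) ⬝ᵥ v)) * s - ε * (v ⬝ᵥ v) * s ^ 2)) 0 := by
    have hopen : ∀ᶠ s : ℝ in nhds 0, (z + s • v - x₀) ⬝ᵥ (z + s • v - x₀) < r ^ 2 := by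
      refine ((hcq.comp hcl).tendsto 0).eventually_lt_const ?_
      simpa using hzlt
    filter_upwards [hopen] with s hs
    have hsK : z + s • v ∈ K := by
      refine ⟨?_, hs.le⟩
      rw [add_dotProduct, smul_dotProduct, hv, smul_zero, add_zero, hz.1]
    have h1 : f z - ε * ((z - x₀) ⬝ᵥ (z - x₀)) ≤
        f (z + s • v) - ε * ((z + s • v - x₀) ⬝ᵥ (z + s • v - x₀)) := hzmin hsK
    have h2 : z + s • v - x₀ = (z - x₀) + s • v := by abel
    have h3 : (z - x₀ + s • v) ⬝ᵥ (z - x₀ + s • v) =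
        (z - x₀) ⬝ᵥ (z - x₀) + 2 * s * ((z - x₀) ⬝ᵥ v) + s ^ 2 * (v ⬝ᵥ v) := by
      simp only [add_dotProduct, dotProduct_add, smul_dotProduct, dotProduct_smul, smul_eq_mul]
      rw [dotProduct_comm v (z - x₀)]
      ring
    simp only [hf, h2, map_add, map_smul, smul_eq_mul, h3] at h1
    simp only [zero_smul, add_zero, mul_zero, ne_eq, OfNat.ofNat_ne_zero, not_false_eq_true,
      zero_pow, sub_zero]
    linarith
  have := le_hessian_of_isLocalMin (hS z (hKF hz)) hmin
  linarith

end Convexity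

/-! ### Boundary behaviour of symplectic potentials -/

section Boundary

open Matrix Topology

variable {n : ℕ} {ι : Type*}

/-- The bordered matrix `[[A, β], [βᵀ, -2 l]]` is invertible at a point where `l = 0` and `A` is
definite on `β^⊥`. Hence the system `A R + m β = 0`, `⟨β, R⟩ - 2 l m = 1` is smoothly solvable
near such a point. -/
theorem exists_bordered_solution {A : (Fin n → ℝ) → Matrix (Fin n) (Fin n) ℝ}
    {l : (Fin n → ℝ) → ℝ} {β p : Fin n → ℝ} (hA : ∀ i j, ContDiffAt ℝ ∞ (fun x => A x i j) p)
    (hl : ContDiffAt ℝ ∞ l p) (hl0 : l p = 0) (hβ : β ≠ 0)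
    (hpos : ∀ v, v ⬝ᵥ β = 0 → v ⬝ᵥ A p *ᵥ v = 0 → v = 0) :
    ∃ (R : (Fin n → ℝ) → Fin n → ℝ) (m : (Fin n → ℝ) → ℝ),
      (∀ i, ContDiffAt ℝ ∞ (fun x => R x i) p) ∧
      ∀ᶠ x in 𝓝 p, A x *ᵥ R x + m x • β = 0 ∧ β ⬝ᵥ R x = 1 + 2 * l x * m x := by
  set B : (Fin n → ℝ) → Matrix (Fin n ⊕ Unit) (Fin n ⊕ Unit) ℝ := fun x =>
    fromBlocks (A x) (replicateCol Unit β) (replicateRow Unit β) (of fun _ _ => -2 * l x) with hB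
  have hBc : ∀ i j, ContDiffAt ℝ ∞ (fun x => B x i j) p := by
    rintro (i | i) (j | j)
    · exact hA i j
    · exact contDiffAt_const
    · exact contDiffAt_const
    · exact contDiffAt_const.mul hl
  have hdet : (B p).det ≠ 0 := by
    intro h0
    obtain ⟨w, hw0, hw⟩ := exists_mulVec_eq_zero_iff.2 h0
    rw [hB, fromBlocks_mulVec] at hw
    have h1 : ∀ i, (A p *ᵥ (w ∘ Sum.inl)) i + β i * w (Sum.inr ()) = 0 := fun i => by
      simpa [mulVec, dotProduct] using congrFun hw (Sum.inl i)
    have h2 : (w ∘ Sum.inl) ⬝ᵥ β = 0 := by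
      have := congrFun hw (Sum.inr ())
      simpa [mulVec, dotProduct, hl0, mul_comm] using this
    have h3 : (w ∘ Sum.inl) ⬝ᵥ A p *ᵥ (w ∘ Sum.inl) = 0 := by
      have h4 : A p *ᵥ (w ∘ Sum.inl) = -w (Sum.inr ()) • β := by
        funext i
        have := h1 i
        simp only [Pi.smul_apply, smul_eq_mul]
        linarith
      rw [h4, dotProduct_smul, h2, smul_zero]
    have h5 := hpos _ h2 h3
    obtain ⟨i, hi⟩ := Function.ne_iff.1 hβ
    have h6 : w (Sum.inr ()) = 0 := by
      have := h1 i
      rw [h5, mulVec_zero, Pi.zero_apply, zero_add] at this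
      exact (mul_eq_zero.1 this).resolve_left hi
    refine hw0 (funext ?_)
    rintro (j | j)
    · exact congrFun h5 j
    · exact h6
  refine ⟨fun x i => (B x)⁻¹ (Sum.inl i) (Sum.inr ()), fun x => (B x)⁻¹ (Sum.inr ()) (Sum.inr ()),
    fun i => ContDiffAt.matrix_inv_apply hBc hdet _ _, ?_⟩
  filter_upwards [(ContDiffAt.matrix_det hBc).continuousAt.eventually_ne hdet] with x hx
  have hmul : B x * (B x)⁻¹ = 1 := mul_nonsing_inv _ (isUnit_iff_ne_zero.2 hx)
  constructor
  · funext i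
    have := congrFun (congrFun hmul (Sum.inl i)) (Sum.inr ())
    rw [mul_apply, Fintype.sum_sum_type] at this
    simpa [hB, mulVec, dotProduct, mul_comm] using this
  · have := congrFun (congrFun hmul (Sum.inr ())) (Sum.inr ())
    have e1 : ∀ j, B x (Sum.inr ()) (Sum.inl j) = β j := fun _ => rfl
    have e2 : B x (Sum.inr ()) (Sum.inr ()) = -2 * l x := rfl
    simp only [mul_apply, Fintype.sum_sum_type, e1, Finset.univ_unique, Finset.sum_singleton,
      PUnit.default_eq_unit, e2, one_apply_eq] at this
    simp only [dotProduct]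
    linarith

/-- The Hessian of `½ l log l + S` for an affine function `l` with linear part `β`. -/
theorem hessian_log_singularity {φ S l : (Fin n → ℝ) → ℝ} {N : Set (Fin n → ℝ)} {β x : Fin n → ℝ}
    (hN : IsOpen N) (hx : x ∈ N) (hS : ContDiffOn ℝ ∞ S N)
    (hl : ∀ z, HasFDerivAt l (∑ i, β i • (ContinuousLinearMap.proj i : (Fin n → ℝ) →L[ℝ] ℝ)) z)
    (hlpos : ∀ z ∈ N, 0 < l z)
    (hφ : ∀ z ∈ N, φ z = 1 / 2 * (l z * Real.log (l z)) + S z) (i j : Fin n) :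
    hessian φ x i j = β i * β j / (2 * l x) + hessian S x i j := by
  have hl1 : ∀ z k, fderiv ℝ l z (Pi.single k 1) = β k := fun z k => by
    rw [(hl z).fderiv]
    simp [Pi.single_apply]
  have hg : ∀ z ∈ N, euclGrad φ z j =
      1 / 2 * (β j * (Real.log (l z) + 1)) + euclGrad S z j := by
    intro z hz
    have h1 : φ =ᶠ[𝓝 z] fun z => 1 / 2 * (l z * Real.log (l z)) + S z := by
      filter_upwards [hN.mem_nhds hz] with w hw
      exact hφ w hw
    have h2 := ((((hl z).fun_mul ((hl z).log (hlpos z hz).ne')).const_mul (1 / 2)).fun_add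
      ((hS.contDiffAt (hN.mem_nhds hz)).differentiableAt (by norm_num)).hasFDerivAt).fderiv
    rw [h1.euclGrad_eq, euclGrad, h2, euclGrad, ← (hl z).fderiv]
    simp only [_root_.add_apply, _root_.smul_apply, smul_eq_mul, hl1]
    field_simp [(hlpos z hz).ne']
    ring
  have h3 : (fun z => euclGrad φ z j) =ᶠ[𝓝 x] fun z =>
      1 / 2 * (β j * (Real.log (l z) + 1)) + euclGrad S z j := by
    filter_upwards [hN.mem_nhds hx] with w hw
    exact hg w hw
  have h4 := ((((((hl x).log (hlpos x hx).ne').add_const 1).const_mul (β j)).const_mul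
    (1 / 2)).fun_add (((hS.contDiffAt (hN.mem_nhds hx)).euclGrad_apply j).differentiableAt
      (by norm_num)).hasFDerivAt).fderiv
  have h5 : ∀ u, hessian u x i j = fderiv ℝ (fun z => euclGrad u z j) x (Pi.single i 1) :=
    fun _ => rfl
  rw [h5, h5, h3.fderiv_eq, h4, ← (hl x).fderiv]
  simp only [_root_.add_apply, _root_.smul_apply, smul_eq_mul, hl1]
  field_simp [(hlpos x hx).ne']

theorem facetFun_eq_dotProduct (b : ι → Fin n → ℤ) (σ : ι) (x : Fin n → ℝ) :
    facetFun b σ x = x ⬝ᵥ (fun i => (b σ i : ℝ)) + 1 := rfl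

theorem facetFun_add_smul (b : ι → Fin n → ℤ) (σ : ι) (x v : Fin n → ℝ) (s : ℝ) :
    facetFun b σ (x + s • v) = facetFun b σ x + s * (v ⬝ᵥ fun i => (b σ i : ℝ)) := by
  simp only [facetFun_eq_dotProduct, add_dotProduct, smul_dotProduct, smul_eq_mul]
  ring

theorem isOpen_facetFun_pos [Finite ι] (b : ι → Fin n → ℤ) (p : ι → Prop) :
    IsOpen {x | ∀ σ, p σ → 0 < facetFun b σ x} := by
  simp only [ofPred_forall]
  refine isOpen_iInter_of_finite fun σ => isOpen_iInter_of_finite fun _ => ?_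
  exact isOpen_lt continuous_const (contDiff_facetFun b σ).continuous

theorem interior_fanoPolytope [Finite ι] (b : ι → Fin n → ℤ) :
    interior (fanoPolytope b) = {x | ∀ σ, 0 < facetFun b σ x} := by
  apply Subset.antisymm
  · intro x hx σ
    by_contra! hle
    have h0 : facetFun b σ x = 0 := le_antisymm hle (interior_subset hx σ)
    set β : Fin n → ℝ := fun i => (b σ i : ℝ) with hβ
    have hββ : 0 < β ⬝ᵥ β := by
      refine lt_of_le_of_ne (Finset.sum_nonneg fun i _ => mul_self_nonneg _) fun h => ?_
      have h1 : β = 0 := dotProduct_self_eq_zero.1 h.symm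
      rw [facetFun_eq_dotProduct, ← hβ, h1, dotProduct_zero] at h0
      norm_num at h0
    have hcont : Continuous fun s : ℝ => x + s • β := by fun_prop
    have hev : ∀ᶠ s : ℝ in 𝓝 0, x + s • β ∈ fanoPolytope b := by
      refine hcont.continuousAt.preimage_mem_nhds ?_
      simpa using mem_interior_iff_mem_nhds.1 hx
    obtain ⟨s, hs, hs0⟩ := ((hev.filter_mono nhdsWithin_le_nhds).and
      (self_mem_nhdsWithin : ∀ᶠ s : ℝ in 𝓝[<] 0, s ∈ Iio 0)).exists
    have h2 := hs σ
    rw [facetFun_add_smul, h0, zero_add] at h2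
    exact absurd h2 (not_le.2 (mul_neg_of_neg_of_pos hs0 hββ))
  · refine interior_maximal (fun x hx σ => (hx σ).le) ?_
    simpa using isOpen_facetFun_pos b fun _ => True

theorem openFace_empty [Finite ι] (b : ι → Fin n → ℤ) :
    openFace b ∅ = interior (fanoPolytope b) := by
  rw [interior_fanoPolytope]
  ext x
  simp [openFace]

variable [Fintype ι]

/-- Near the relative interior of the facet `F_ρ`, a symplectic potential is
`½ L_ρ log L_ρ` plus a smooth function. -/
theorem IsSymplecticPotential.exists_smooth_part {b : ι → Fin n → ℤ} {φ : (Fin n → ℝ) → ℝ}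
    (hφ : IsSymplecticPotential b φ) (ρ : ι) :
    ∃ (N : Set (Fin n → ℝ)) (S : (Fin n → ℝ) → ℝ), IsOpen N ∧
      (∀ x ∈ N, ∀ σ, σ ≠ ρ → 0 < facetFun b σ x) ∧
      (∀ x, 0 ≤ facetFun b ρ x → (∀ σ, σ ≠ ρ → 0 < facetFun b σ x) → x ∈ N) ∧
      ContDiffOn ℝ ∞ S N ∧ ∀ x ∈ N, 0 ≤ facetFun b ρ x →
        φ x = 1 / 2 * (facetFun b ρ x * Real.log (facetFun b ρ x)) + S x := by
  classical
  obtain ⟨-, -, W, h, hW, hPW, hh, hφh⟩ := hφ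
  have hP : ∀ x, 0 ≤ facetFun b ρ x → (∀ σ, σ ≠ ρ → 0 < facetFun b σ x) →
      x ∈ fanoPolytope b := fun x h0 h1 σ => by
    by_cases hσ : σ = ρ
    · exact hσ ▸ h0
    · exact (h1 σ hσ).le
  refine ⟨W ∩ {x | ∀ σ, σ ≠ ρ → 0 < facetFun b σ x}, fun x =>
    1 / 2 * ∑ σ ∈ Finset.univ.erase ρ, facetFun b σ x * Real.log (facetFun b σ x) + h x,
    hW.inter (isOpen_facetFun_pos b _), fun x hx => hx.2,
    fun x h0 h1 => ⟨hPW (hP x h0 h1), h1⟩, ?_, ?_⟩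
  · refine ContDiffOn.add (contDiffOn_const.mul (ContDiffOn.sum fun σ hσ => ?_))
      (hh.mono inter_subset_left)
    refine (contDiff_facetFun b σ).contDiffOn.mul ((contDiff_facetFun b σ).contDiffOn.log ?_)
    exact fun x hx => (hx.2 σ (Finset.ne_of_mem_erase hσ)).ne'
  · intro x hx h0
    rw [hφh x (hP x h0 hx.2), guillemin, ← Finset.add_sum_erase _ _ (Finset.mem_univ ρ)]
    ring

/-- A constant value on the interior of `P` of the function `⟨-½ div H + H a - x, b_ρ⟩` vanishes.
With `L = L_ρ`, the vector field `H b_ρ` extends smoothly across suitable points of the facet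
`F_ρ`, in the form `2 L R` with `⟨b_ρ, R⟩ = 1` on the facet. At such a point `H b_ρ = 0`,
`div (H b_ρ) = 2` and `⟨x, b_ρ⟩ = -1`. -/
theorem IsSymplecticPotential.constant_eq_zero {b : ι → Fin n → ℤ} {φ : (Fin n → ℝ) → ℝ}
    (hφ : IsSymplecticPotential b φ) (h : IsHessianPotential (interior (fanoPolytope b)) φ)
    {ρ : ι} (hρ : ∃ x, facetFun b ρ x = 0 ∧ ∀ σ, σ ≠ ρ → 0 < facetFun b σ x) {a : Fin n → ℝ}
    {c : ℝ} (hc : ∀ x ∈ interior (fanoPolytope b), ∑ k, (-(1 / 2) * invHessianDiv φ x k +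
      ((hessian φ x)⁻¹ *ᵥ a) k - x k) * (b ρ k : ℝ) = c) : c = 0 := by
  obtain ⟨x₀, hx₀, hx₀'⟩ := hρ
  obtain ⟨N, S, hN, hNpos, hNmem, hS, hφS⟩ := hφ.exists_smooth_part ρ
  set β : Fin n → ℝ := fun i => (b ρ i : ℝ) with hβdef
  have hβ : β ≠ 0 := by
    intro h0
    rw [facetFun_eq_dotProduct, ← hβdef, h0, dotProduct_zero] at hx₀
    norm_num at hx₀
  have hββ : 0 < β ⬝ᵥ β :=
    lt_of_le_of_ne (Finset.sum_nonneg fun i _ => mul_self_nonneg _) fun h0 =>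
      hβ (dotProduct_self_eq_zero.1 h0.symm)
  have hface : ∀ x, x ∈ openFace b {ρ} ↔
      x ∈ {x | ∀ σ, σ ≠ ρ → 0 < facetFun b σ x} ∧ x ⬝ᵥ β = x₀ ⬝ᵥ β := by
    intro x
    have h1 : facetFun b ρ x = 0 ↔ x ⬝ᵥ β = x₀ ⬝ᵥ β := by
      rw [facetFun_eq_dotProduct] at hx₀ ⊢
      constructor <;> intro h2 <;> linarith
    simp [openFace, h1, and_comm]
  have hfaceN : openFace b {ρ} ⊆ N := fun x hx =>
    hNmem x (hx.1 ρ rfl).ge fun σ hσ => hx.2 σ hσ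
  have hconv : StrictConvexOn ℝ (openFace b {ρ}) S := by
    refine (hφ.2.1 {ρ}).2.congr fun x hx => ?_
    rw [hφS x (hfaceN hx) (hx.1 ρ rfl).ge, hx.1 ρ rfl]
    simp
  obtain ⟨p, hp, ε, hε, hpos⟩ := hconv.exists_hessian_pos ((hface x₀).2 ⟨hx₀', rfl⟩)
    (fun x hx => hS.contDiffAt (hN.mem_nhds (hfaceN hx))) (isOpen_facetFun_pos b _) hface
  have hpN := hfaceN hp
  have hLp : facetFun b ρ p = 0 := hp.1 ρ rfl
  have hLc : ContDiff ℝ ∞ (facetFun b ρ) := contDiff_facetFun b ρ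
  obtain ⟨R, m, hR, hRm⟩ := exists_bordered_solution (A := hessian S) (l := facetFun b ρ)
    (β := β) (p := p) (hS.contDiffAt (hN.mem_nhds hpN)).hessian_apply hLc.contDiffAt hLp hβ
    (fun v hv1 hv2 => by
      have h1 := hpos v hv1
      rw [hv2] at h1
      refine dotProduct_self_eq_zero.1 (le_antisymm ?_
        (Finset.sum_nonneg fun i _ => mul_self_nonneg _))
      exact nonpos_of_mul_nonpos_right h1 hε)
  -- The smooth extension of `H b_ρ`.
  set Y : (Fin n → ℝ) → Fin n → ℝ := fun x i => 2 * facetFun b ρ x * R x i with hY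
  have hYc : ∀ i, ContDiffAt ℝ ∞ (fun x => Y x i) p := fun i =>
    (contDiffAt_const.mul hLc.contDiffAt).mul (hR i)
  have hHY : ∀ᶠ x in 𝓝 p, x ∈ interior (fanoPolytope b) → (hessian φ x)⁻¹ *ᵥ β = Y x := by
    filter_upwards [hRm, hN.mem_nhds hpN] with x hx hxN hxP
    have hxL : ∀ σ, 0 < facetFun b σ x := by
      rw [interior_fanoPolytope] at hxP
      exact hxP
    have hL := hxL ρ
    have hhess : ∀ i j, hessian φ x i j =
        β i * β j / (2 * facetFun b ρ x) + hessian S x i j :=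
      hessian_log_singularity (N := N ∩ {z | 0 < facetFun b ρ z})
        (hN.inter (isOpen_lt continuous_const hLc.continuous)) ⟨hxN, hL⟩
        (hS.mono inter_subset_left) (hasFDerivAt_facetFun b ρ) (fun z hz => hz.2)
        (fun z hz => hφS z hz.1 hz.2.le)
    have hG : hessian φ x *ᵥ Y x = β := by
      funext i
      have h1 : (hessian S x *ᵥ R x) i + m x * β i = 0 := congrFun hx.1 i
      have h2 : ∑ j, β j * R x j = 1 + 2 * facetFun b ρ x * m x := hx.2
      have h3 : (hessian φ x *ᵥ Y x) i =
          β i * ∑ j, β j * R x j + 2 * facetFun b ρ x * (hessian S x *ᵥ R x) i := by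
        simp only [mulVec, dotProduct, hhess, hY, Finset.mul_sum, ← Finset.sum_add_distrib]
        refine Finset.sum_congr rfl fun j _ => ?_
        field_simp
      rw [h3, h2]
      linear_combination 2 * facetFun b ρ x * h1
    rw [← hG, mulVec_mulVec, (h.posDef x hxP).inv_mul_self, one_mulVec]
  -- The continuous extension of the function in question.
  set e : (Fin n → ℝ) → ℝ := fun x =>
    -(1 / 2) * ∑ i, euclGrad (fun z => Y z i) x i + ∑ i, a i * Y x i - x ⬝ᵥ β with he
  have hec : ContinuousAt e p := by
    have h1 : ∀ i, ContinuousAt (fun x => euclGrad (fun z => Y z i) x i) p := fun i =>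
      ((hYc i).euclGrad_apply i).continuousAt
    have h2 : ∀ i, ContinuousAt (fun x => Y x i) p := fun i => (hYc i).continuousAt
    refine ((continuousAt_const.mul (tendsto_finsetSum _ fun i _ => h1 i)).add
      (tendsto_finsetSum _ fun i _ => continuousAt_const.mul (h2 i))).sub ?_
    have h3 : Continuous fun x : Fin n → ℝ => x ⬝ᵥ β := by
      simp only [dotProduct]
      fun_prop
    exact h3.continuousAt
  have hep : e p = 0 := by
    have hY0 : ∀ i, Y p i = 0 := fun i => by simp [hY, hLp]
    have hYd : ∀ i, euclGrad (fun z => Y z i) p i = 2 * (β i * R p i) := by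
      intro i
      have h1 := ((hLc.contDiffAt.differentiableAt (by norm_num : (∞ : WithTop ℕ∞) ≠ 0)
        (x := p)).hasFDerivAt.const_mul 2).fun_mul
        (((hR i).differentiableAt (by norm_num)).hasFDerivAt)
      rw [euclGrad, h1.fderiv]
      simp only [_root_.add_apply, _root_.smul_apply, smul_eq_mul, hLp]
      have h2 : fderiv ℝ (facetFun b ρ) p (Pi.single i 1) = β i := euclGrad_facetFun b ρ p i
      rw [h2]
      ring
    have hβR : ∑ i, β i * R p i = 1 := by
      have := hRm.self_of_nhds.2
      rw [hLp] at this
      simpa [dotProduct] using this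
    have hpβ : p ⬝ᵥ β = -1 := by
      rw [facetFun_eq_dotProduct] at hLp
      linarith
    simp only [he, hYd, hY0, hpβ, ← Finset.mul_sum, hβR]
    norm_num
  have hcl : p ∈ closure (interior (fanoPolytope b)) := by
    have hcont : Continuous fun s : ℝ => p + s • β := by fun_prop
    refine mem_closure_of_tendsto (b := 𝓝[>] (0 : ℝ)) (f := fun s : ℝ => p + s • β) ?_ ?_
    · have := (hcont.tendsto 0).mono_left (nhdsWithin_le_nhds (s := Ioi 0))
      simpa using this
    · have hO : ∀ᶠ s : ℝ in 𝓝 0, p + s • β ∈ {x | ∀ σ, σ ≠ ρ → 0 < facetFun b σ x} := by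
        refine hcont.continuousAt.preimage_mem_nhds ((isOpen_facetFun_pos b _).mem_nhds ?_)
        simpa using hNpos p hpN
      filter_upwards [hO.filter_mono nhdsWithin_le_nhds, self_mem_nhdsWithin] with s hs hs0
      rw [interior_fanoPolytope]
      intro σ
      by_cases hσ : σ = ρ
      · subst hσ
        rw [facetFun_add_smul, hLp, zero_add]
        exact mul_pos hs0 hββ
      · exact hs σ hσ
  have hconst : ∀ᶠ x in 𝓝[interior (fanoPolytope b)] p, e x = c := by
    filter_upwards [hHY.eventually_nhds.filter_mono nhdsWithin_le_nhds, self_mem_nhdsWithin]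
      with x hx hxP
    rw [← hc x hxP]
    have hloc : ∀ i, (fun z => ((hessian φ z)⁻¹ *ᵥ β) i) =ᶠ[𝓝 x] fun z => Y z i := fun i => by
      filter_upwards [hx, isOpen_interior.mem_nhds hxP] with z hz hzP
      rw [hz hzP]
    have h1 : ∑ i, euclGrad (fun z => Y z i) x i = ∑ k, invHessianDiv φ x k * β k := by
      simp only [invHessianDiv, Finset.sum_mul]
      rw [Finset.sum_comm]
      refine Finset.sum_congr rfl fun i _ => ?_
      have hHd := fun k => (h.contDiffAt_inv hxP i k).differentiableAt
        (by norm_num : (∞ : WithTop ℕ∞) ≠ 0)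
      rw [← (hloc i).euclGrad_eq, euclGrad]
      simp only [mulVec, dotProduct]
      rw [fderiv_fun_sum fun k _ => (hHd k).mul_const _, _root_.sum_apply]
      refine Finset.sum_congr rfl fun k _ => ?_
      rw [fderiv_mul_const (hHd k), _root_.smul_apply, smul_eq_mul, mul_comm, euclGrad]
    have h2 : ∑ i, a i * Y x i = ∑ k, ((hessian φ x)⁻¹ *ᵥ a) k * β k := by
      rw [← hx.self_of_nhds hxP]
      have hsymm : (hessian φ x)⁻¹ᵀ = (hessian φ x)⁻¹ := by
        ext i j
        exact h.inv_symm hxP j i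
      have := dotProduct_mulVec a (hessian φ x)⁻¹ β
      rwa [← mulVec_transpose, hsymm] at this
    simp only [he]
    rw [h1, h2, Finset.mul_sum, ← Finset.sum_add_distrib, dotProduct, ← Finset.sum_sub_distrib]
    simp only [hβdef]
    exact Finset.sum_congr rfl fun k _ => by ring
  have : (𝓝[interior (fanoPolytope b)] p).NeBot := mem_closure_iff_nhdsWithin_neBot.1 hcl
  have h1 : Filter.Tendsto e (𝓝[interior (fanoPolytope b)] p) (𝓝 (e p)) :=
    hec.tendsto.mono_left nhdsWithin_le_nhds
  have h2 : Filter.Tendsto e (𝓝[interior (fanoPolytope b)] p) (𝓝 c) :=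
    tendsto_const_nhds.congr' (hconst.mono fun x hx => hx.symm)
  rw [← tendsto_nhds_unique h1 h2, hep]

end Boundary

/-! ### Action-angle coordinates on a toric Kähler manifold -/

section Congruence

open LocalKahler Topology

variable {n : ℕ} {g : Coord n → Coord n →L[ℝ] Coord n →L[ℝ] ℝ}
  {J : Coord n → Coord n →L[ℝ] Coord n} {y : Coord n}

theorem LocalKahler.cgrad_congr {v v' : Coord n → ℂ} (h : v =ᶠ[𝓝 y] v') :
    cgrad g J v y = cgrad g J v' y := by
  have hre : (fun z => (v z).re) =ᶠ[𝓝 y] fun z => (v' z).re := h.mono fun z hz => by simp only [hz]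
  have him : (fun z => (v z).im) =ᶠ[𝓝 y] fun z => (v' z).im := h.mono fun z hz => by simp only [hz]
  rw [cgrad, cgrad, grad, grad, grad, grad, hre.fderiv_eq, him.fderiv_eq]

theorem LocalKahler.complexLaplacianReal_congr {w u u' : Coord n → ℝ} (h : u =ᶠ[𝓝 y] u') :
    complexLaplacianReal g J w u y = complexLaplacianReal g J w u' y := by
  have hpd : ∀ i, (fun z => Real.sqrt (gram g z).det * ∑ j, (gram g z)⁻¹ i j * pd u j z) =ᶠ[𝓝 y]
      fun z => Real.sqrt (gram g z).det * ∑ j, (gram g z)⁻¹ i j * pd u' j z := fun i => by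
    filter_upwards [h.fderiv (𝕜 := ℝ)] with z hz
    simp only [pd, hz]
  simp only [complexLaplacianReal, weightedLaplacian, bOperator, h.fderiv_eq, laplacian]
  simp only [pd] at hpd ⊢
  simp only [(hpd _).fderiv_eq]

theorem LocalKahler.complexLaplacian_congr {w : Coord n → ℝ} {v v' : Coord n → ℂ}
    (h : v =ᶠ[𝓝 y] v') : complexLaplacian g J w v y = complexLaplacian g J w v' y := by
  have hre : (fun z => (v z).re) =ᶠ[𝓝 y] fun z => (v' z).re := h.mono fun z hz => by simp only [hz]
  have him : (fun z => (v z).im) =ᶠ[𝓝 y] fun z => (v' z).im := h.mono fun z hz => by simp only [hz]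
  rw [complexLaplacian, complexLaplacian, complexLaplacianReal_congr hre,
    complexLaplacianReal_congr him]

end Congruence

namespace ToricKahler

open Matrix LocalKahler Topology

variable {n : ℕ} {M : Type*} [TopologicalSpace M] [ChartedSpace (EModel n) M]
  [IsManifold (𝓡 (2 * n)) ∞ M] [AddAction (Torus n) M] {T : ToricKahler n M} {ι : Type*}
  {b : ι → Fin n → ℤ} {Ψ : Coord n → M}

theorem IsActionAngle.isLocalDiffeomorphAt (hΨ : T.IsActionAngle b Ψ) {y : Coord n}
    (hy : y ∈ angleDomain b) : IsLocalDiffeomorphAt 𝓘(ℝ, Coord n) (𝓡 (2 * n)) ∞ Ψ y :=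
  hΨ.param.2 ⟨y, hy⟩

theorem IsActionAngle.paramDeriv_isInvertible (hΨ : T.IsActionAngle b Ψ)
    {y : Coord n} (hy : y ∈ angleDomain b) : (paramDeriv Ψ y).IsInvertible :=
  ⟨(hΨ.isLocalDiffeomorphAt hy).mfderivToContinuousLinearEquiv (by norm_num), rfl⟩

theorem IsActionAngle.g_pos (hΨ : T.IsActionAngle b Ψ) {y : Coord n}
    (hy : y ∈ angleDomain b) {v : Coord n} (hv : v ≠ 0) : 0 < T.g Ψ y v v := by
  refine T.metric.pos (Ψ y) (paramDeriv Ψ y v) fun h0 => hv ?_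
  have := (hΨ.paramDeriv_isInvertible hy).inverse_apply_self v
  rw [h0, map_zero] at this
  exact this.symm

/-- In action-angle coordinates the fundamental field of `a` is `∑ⱼ aⱼ ∂/∂tⱼ`. -/
theorem IsActionAngle.paramDeriv_fundamental (hΨ : T.IsActionAngle b Ψ) {y : Coord n}
    (hy : y ∈ angleDomain b) (a : Fin n → ℝ) :
    paramDeriv Ψ y (Sum.elim (0 : Fin n → ℝ) a) = fundamentalField a (Ψ y) := by
  have hcurve : (fun s : ℝ => toTorus (s • a) +ᵥ Ψ y) =
      Ψ ∘ fun s : ℝ => y + s • Sum.elim (0 : Fin n → ℝ) a := by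
    funext s
    have h1 := hΨ.equivariant y hy (s • a)
    have h2 : (Sum.elim (fun _ => (0 : ℝ)) (s • a) : Coord n) =
        s • Sum.elim (0 : Fin n → ℝ) a := by
      funext i
      rcases i with i | i <;> simp
    rw [h2] at h1
    exact h1.symm
  have hline : HasFDerivAt (fun s : ℝ => y + s • (Sum.elim (0 : Fin n → ℝ) a : Coord n))
      (ContinuousLinearMap.toSpanSingleton ℝ (Sum.elim (0 : Fin n → ℝ) a : Coord n)) 0 := by
    have : HasDerivAt (fun s : ℝ => y + s • (Sum.elim (0 : Fin n → ℝ) a : Coord n))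
        (Sum.elim (0 : Fin n → ℝ) a : Coord n) 0 := by
      simpa using ((hasDerivAt_id (0 : ℝ)).smul_const
        (Sum.elim (0 : Fin n → ℝ) a : Coord n)).const_add y
    exact this.hasFDerivAt
  have hy0 : y + (0 : ℝ) • (Sum.elim (0 : Fin n → ℝ) a : Coord n) = y := by simp
  have hΨd : HasMFDerivAt 𝓘(ℝ, Coord n) (𝓡 (2 * n)) Ψ y (paramDeriv Ψ y) :=
    ((hΨ.isLocalDiffeomorphAt hy).mdifferentiableAt (by norm_num)).hasMFDerivAt
  -- The base point `y + 0 • v` is generalized, as it is equal to `y` only propositionally.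
  have hmf := fun (z : Coord n) (hz : y + (0 : ℝ) • (Sum.elim (0 : Fin n → ℝ) a : Coord n) = z)
    (D : Coord n →L[ℝ] EModel n) (hD : HasMFDerivAt 𝓘(ℝ, Coord n) (𝓡 (2 * n)) Ψ z D) =>
    HasMFDerivAt.comp (I' := 𝓘(ℝ, Coord n)) (0 : ℝ) (hz ▸ hD) hline.hasMFDerivAt
  have h3 := (hmf y hy0 (paramDeriv Ψ y) hΨd).mfderiv
  rw [fundamentalField, hcurve]
  have h4 := congrArg (fun l : ℝ →L[ℝ] EModel n => l 1) h3
  exact (congrArg (paramDeriv Ψ y) (one_smul ℝ _).symm).trans h4.symm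

/-- The root function does not depend on the choice of the angles, because `α` is integral. -/
theorem IsActionAngle.rootFunction_apply (hΨ : T.IsActionAngle b Ψ) (φ : (Fin n → ℝ) → ℝ)
    (α : Fin n → ℤ) (ρ : ι) {y : Coord n} (hy : y ∈ angleDomain b) :
    rootFunction b Ψ φ α ρ (Ψ y) = rootExpr b φ α ρ y := by
  have : Nonempty (Coord n) := ⟨0⟩
  set y' := Function.invFunOn Ψ (angleDomain b) (Ψ y) with hy'
  have hmem : y' ∈ angleDomain b := Function.invFunOn_mem ⟨y, hy, rfl⟩
  have heq : Ψ y' = Ψ y := Function.invFunOn_eq ⟨y, hy, rfl⟩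
  obtain ⟨hx, ht⟩ := hΨ.injective y' hmem y hy heq
  have hx' : actions y' = actions y := funext hx
  have ht' : ∀ k, ∃ m : ℤ, y' (Sum.inr k) - y (Sum.inr k) = 2 * Real.pi * m := fun k =>
    Real.Angle.angle_eq_iff_two_pi_dvd_sub.1 (congrFun ht k)
  choose m hm using ht'
  have key : rootExpr b φ α ρ y' = rootExpr b φ α ρ y := by
    rw [rootExpr_eq, rootExpr_eq, hx', monomial, monomial, hx']
    congr 1
    refine Complex.exp_eq_exp_iff_exists_int.2 ⟨-∑ k, α k * m k, ?_⟩
    push_cast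
    rw [← Finset.sum_neg_distrib, ← Finset.sum_neg_distrib, ← Finset.sum_neg_distrib,
      Finset.sum_mul, ← Finset.sum_add_distrib]
    refine Finset.sum_congr rfl fun k _ => ?_
    have h1 : (angles y' k : ℂ) = angles y k + 2 * Real.pi * m k := by
      rw [← sub_eq_iff_eq_add']
      exact_mod_cast hm k
    rw [h1]
    ring
  exact key

variable [Fintype ι] {φ : (Fin n → ℝ) → ℝ}

theorem IsPotentialOf.isHessianKahler (hΨ : T.IsActionAngle b Ψ) (hφ : T.IsPotentialOf b Ψ φ) :
    IsHessianKahler (interior (fanoPolytope b)) φ (T.g Ψ) (T.cs Ψ) := by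
  have hsmooth : ContDiffOn ℝ ∞ φ (interior (fanoPolytope b)) := by
    rw [← openFace_empty]
    exact (hφ.1.2.1 ∅).1
  refine ⟨⟨isOpen_interior, hsmooth, fun x hx => ?_⟩, fun y hy => hφ.2 y hy,
    fun y hy => hΨ.symplectic y hy⟩
  refine PosDef.of_dotProduct_mulVec_pos (IsHermitian.ext fun i j => ?_) fun v hv => ?_
  · simpa using hessian_symm (hsmooth.contDiffAt (isOpen_interior.mem_nhds hx)) j i
  · have hy : (Sum.elim x 0 : Coord n) ∈ angleDomain b := hx
    have hv' : (Sum.elim v 0 : Coord n) ≠ 0 := fun h0 => hv (congrArg actions h0)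
    have h1 := hΨ.g_pos hy hv'
    rw [hφ.2 _ hy, potentialMetric_eq, actions_elim, actions_elim, angles_elim, mulVec_zero,
      dotProduct_zero, add_zero] at h1
    simpa using h1

theorem IsPotentialOf.pullVector_J_fundamentalField (hΨ : T.IsActionAngle b Ψ)
    (hφ : T.IsPotentialOf b Ψ φ) {y : Coord n} (hy : y ∈ angleDomain b) (a : Fin n → ℝ) :
    pullVector (fun p => T.J p (fundamentalField a p)) Ψ y =
      Sum.elim (-((hessian φ (actions y))⁻¹ *ᵥ a)) 0 := by
  have h1 := (hφ.isHessianKahler hΨ).J_apply (y := y) hy (Sum.elim (0 : Fin n → ℝ) a)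
  rw [actions_elim, angles_elim, mulVec_zero] at h1
  rw [← h1, pullVector, ← hΨ.paramDeriv_fundamental hy]
  rfl

theorem IsPotentialOf.isHolCoord_logCoord (hΨ : T.IsActionAngle b Ψ)
    (hφ : T.IsPotentialOf b Ψ φ) : IsHolCoord (T.cs Ψ) (angleDomain b) (logCoord φ) := by
  have h := hφ.isHessianKahler hΨ
  refine ⟨fun y hy => (contDiffAt_logCoord (h.contDiffAt hy)).contDiffWithinAt,
    fun y hy => ⟨fun v => ?_, h.fderiv_logCoord_bijective hy⟩⟩
  funext k
  rw [Pi.smul_apply, fderiv_logCoord (h.contDiffAt hy), fderiv_logCoord (h.contDiffAt hy),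
    h.J_apply hy, actions_elim, angles_elim, mulVec_neg, h.mulVec_inv_mulVec hy, smul_eq_mul,
    Pi.neg_apply, Complex.ofReal_neg]
  linear_combination -(angles v k : ℂ) * Complex.I_mul_I

/-- For a soliton, `-½ div H + H a - x` is orthogonal to the facet normals: it is constant by the
soliton equation, and the constant is determined at the boundary. -/
theorem IsKahlerRicciSoliton.sum_eq_zero {a : Fin n → ℝ} (hsol : T.IsKahlerRicciSoliton 1 a)
    (hΨ : T.IsActionAngle b Ψ) (hφ : T.IsPotentialOf b Ψ φ) {ρ : ι}
    (hρ : ∃ x, facetFun b ρ x = 0 ∧ ∀ σ, σ ≠ ρ → 0 < facetFun b σ x)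
    (hconv : IsPreconnected (interior (fanoPolytope b)))
    {x : Fin n → ℝ} (hx : x ∈ interior (fanoPolytope b)) :
    ∑ k, (-(1 / 2) * invHessianDiv φ x k + ((hessian φ x)⁻¹ *ᵥ a) k - x k) * (b ρ k : ℝ) = 0 := by
  have h := hφ.isHessianKahler hΨ
  choose c hc using fun k => h.exists_const_of_soliton hconv
    (W := pullVector (fun p => T.J p (fundamentalField a p)) Ψ) (a := a)
    (fun z hz => hφ.pullVector_J_fundamentalField hΨ hz a) (fun y hy v w => by
      have h1 := hsol _ Ψ hΨ.param (logCoord φ) (hφ.isHolCoord_logCoord hΨ) y hy v w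
      have h2 := congrArg Complex.re h1
      simp only [Complex.ofReal_re, Complex.add_re, Complex.mul_re, Complex.I_re, Complex.I_im,
        Complex.ofReal_im, zero_mul, mul_zero, sub_zero, add_zero, one_mul] at h2
      exact h2) k
  have h0 := hφ.1.constant_eq_zero h.toIsHessianPotential hρ (a := a)
    (c := ∑ k, c k * (b ρ k : ℝ)) fun x hx => Finset.sum_congr rfl fun k _ => by rw [hc k x hx]
  rw [← h0]
  exact Finset.sum_congr rfl fun k _ => by rw [hc k x hx]

theorem IsPotentialOf.contMDiffOn_rootFunction (hΨ : T.IsActionAngle b Ψ)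
    (hφ : T.IsPotentialOf b Ψ φ) (α : Fin n → ℤ) (ρ : ι) :
    ContMDiffOn (𝓡 (2 * n)) 𝓘(ℝ, ℂ) ∞ (rootFunction b Ψ φ α ρ) (T.openOrbit b) := by
  intro p hp
  rw [← hΨ.image] at hp
  obtain ⟨y, hy, rfl⟩ := hp
  have hloc := hΨ.isLocalDiffeomorphAt hy
  have hinv : hloc.localInverse (Ψ y) = y := hloc.localInverse_left_inv hloc.localInverse_mem_target
  have hroot : ContMDiffAt 𝓘(ℝ, Coord n) 𝓘(ℝ, ℂ) ∞ (rootExpr b φ α ρ)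
      (hloc.localInverse (Ψ y)) := by
    rw [hinv]
    exact (contDiffAt_rootExpr ((hφ.isHessianKahler hΨ).contDiffAt hy) b α ρ).contMDiffAt
  have hcomp := hroot.comp (Ψ y) hloc.localInverse_contMDiffAt
  refine (hcomp.congr_of_eventuallyEq ?_).contMDiffWithinAt
  have hdom : ∀ᶠ q in 𝓝 (Ψ y), hloc.localInverse q ∈ angleDomain b :=
    hloc.localInverse_contMDiffAt.continuousAt.preimage_mem_nhds (by
      rw [hinv]
      exact hΨ.param.1.mem_nhds hy)
  filter_upwards [hdom, hloc.localInverse_eventuallyEq_right] with q hq hq'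
  have h1 := hΨ.rootFunction_apply φ α ρ hq
  have h2 : Ψ (hloc.localInverse q) = q := hq'
  rw [h2] at h1
  exact h1

end ToricKahler

theorem convex_fanoPolytope {n : ℕ} {ι : Type*} (b : ι → Fin n → ℤ) :
    Convex ℝ (fanoPolytope b) := by
  intro x hx y hy s t hs ht hst σ
  have h1 : facetFun b σ (s • x + t • y) = s * facetFun b σ x + t * facetFun b σ y := by
    simp only [facetFun_eq_dotProduct, add_dotProduct, smul_dotProduct, smul_eq_mul]
    linear_combination -hst
  rw [h1]
  exact add_nonneg (mul_nonneg hs (hx σ)) (mul_nonneg ht (hy σ))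

theorem mainTheorem5 {n : ℕ} {M : Type*} [TopologicalSpace M] [T2Space M] [CompactSpace M]
    [ConnectedSpace M] [ChartedSpace (EModel n) M] [IsManifold (𝓡 (2 * n)) ∞ M]
    [AddAction (Torus n) M] (T : ToricKahler n M)
    {ι : Type*} [Fintype ι] (b : ι → Fin n → ℤ) (hb : IsSmoothFano b)
    (hP : Set.range T.μ = fanoPolytope b)
    (a : Fin n → ℝ) (hsol : T.IsKahlerRicciSoliton 1 a)
    (Ψ : Coord n → M) (hΨ : T.IsActionAngle b Ψ)
    (φ : (Fin n → ℝ) → ℝ) (hφ : T.IsPotentialOf b Ψ φ)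
    (α : Fin n → ℤ) (ρ : ι) (hα : IsDemazureRoot b α ρ) :
    (∀ y ∈ angleDomain b, rootFunction b Ψ φ α ρ (Ψ y) = rootExpr b φ α ρ y) ∧
    ContMDiffOn (𝓡 (2 * n)) 𝓘(ℝ, ℂ) ∞ (rootFunction b Ψ φ α ρ) (T.openOrbit b) ∧
    ∀ y ∈ angleDomain b,
      T.grad10 Ψ (rootFunction b Ψ φ α ρ) y = demazureField φ α (b ρ) y ∧
      T.complexLaplacian Ψ a
          (fun p => (starRingEnd ℂ) (rootFunction b Ψ φ α ρ p)) y -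
        2 * (starRingEnd ℂ) (rootFunction b Ψ φ α ρ (Ψ y)) = 0 := by
  have h := hφ.isHessianKahler hΨ
  refine ⟨fun y hy => hΨ.rootFunction_apply φ α ρ hy, hφ.contMDiffOn_rootFunction hΨ α ρ,
    fun y hy => ?_⟩
  have hev : (fun z => rootFunction b Ψ φ α ρ (Ψ z)) =ᶠ[nhds y] rootExpr b φ α ρ := by
    filter_upwards [hΨ.param.1.mem_nhds hy] with z hz
    exact hΨ.rootFunction_apply φ α ρ hz
  constructor
  · rw [ToricKahler.grad10, LocalKahler.cgrad_congr hev]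
    exact h.part10_cgrad_rootExpr hy b α ρ
  · rw [ToricKahler.complexLaplacian, hΨ.rootFunction_apply φ α ρ hy, sub_eq_zero,
      LocalKahler.complexLaplacian_congr (hev.mono fun z hz => congrArg (starRingEnd ℂ) hz)]
    refine h.complexLaplacian_conj_rootExpr hy b α ρ (fun z hz => ?_) hα.1
      (hsol.sum_eq_zero hΨ hφ (hb.2.1 ρ) (convex_fanoPolytope b).interior.isPreconnected hy)
    rw [hΨ.moment z hz]
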